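/- **Notation.** Let $\mathbb T=\mathbb R/2\pi\mathbb Z$, $f_k=\int_{\mathbb T}f(x)e^{-ikx}\,dx$, $\widehat u(\tau)=\int_{\mathbb R}u(t)e^{-it\tau}\,dt$, $\langle x\rangle=(1+|x|^2)^{1/2}$. Fix $\alpha,\beta\in\mathbb R$ and put $L_k=k|k|^\alpha$. For $b\in\mathbb R$, the space $Z^b$ consists of the distributions $u$ on $\mathbb R\times\mathbb T$, tempered in $t$ and of mean zero in $x$, for which every $\widehat u_k(\tau)$ is a function and the following norm is finite: $$\|u\|_{Z^b}=\Big(\sum_{k\in\mathbb Z\setminus\{0\}}\int_{\mathbb R}\omega_b(k,\tau)^2\,|\widehat u_k(\tau)|^2\,d\tau\Big)^{1/2},\qquad \omega_b(k,\tau)=\begin{cases}\langle k\rangle^{b\beta}\,\big\langle \tfrac{\tau-L_k}{\langle k\rangle^\beta}\big\rangle^{b}, & -\tfrac12<b<\tfrac12,\\[4pt] \langle k\rangle^{\operatorname{sgn}(b)\beta/2}\,\big\langle \tfrac{\tau-L_k}{\langle k\rangle^\beta}\big\rangle^{b}, & \text{otherwise.}\end{cases}$$ For $T>0$ put $\|u\|_{Z^b_T}=\inf\{\|w\|_{Z^b}: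 w(t)\equiv u(t)\text{ for }t\in[0,T]\}$ (with $\inf\emptyset=\infty$), and let $Z^b_T$ be the set of $u$ with $\|u\|_{Z^b_T}<\infty$; for $b>\frac12$ its elements are $L^2(\mathbb T)$-valued functions of time. On mean-zero distributions, $D^s$ is the Fourier multiplier $|k|^s$. **Lemma (bilinear estimate).** Let $\alpha>1$ and $2-\alpha<\beta\le 1$. Then there exist $\varepsilon>0$, $b>\frac12$ and $C>0$, depending only on $\alpha$ and $\beta$, such that for all $0<T\le 1$ and all $u,v\in Z^b_T$, $$\big\|D^{-\beta(b-\frac12)}\partial_x(uv)\big\|_{Z^{b-1}_T}\le C\,T^{\varepsilon}\,\|u\|_{Z^b_T}\,\|v\|_{Z^b_T}.$$ In particular, this holds in the periodic KdV case $\alpha=2$ for every $0<\beta\le1$. -/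

import Mathlib

open MeasureTheory
open scoped ENNReal Real SchwartzMap FourierTransform

noncomputable section

/-- The period `2π` of the torus is positive. -/
instance factTwoPiPos : Fact (0 < 2 * π) := ⟨Real.two_pi_pos⟩

/-- The torus `𝕋 = ℝ / 2πℤ`, carrying Lebesgue measure of total mass `2π`. -/
abbrev Torus : Type := AddCircle (2 * π)

/-- `L²(𝕋)`, complex valued. -/
abbrev L2Torus : Type := Lp ℂ 2 (volume : Measure Torus)

/-! ### Spatial Fourier series -/

/-- The spatial Fourier coefficients `f_k = ∫_𝕋 f(x) e^{-ikx} dx`. -/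
def spatialCoeff (f : Torus → ℂ) (k : ℤ) : ℂ :=
  ∫ x : Torus, fourier (-k) x * f x

/-- The derivative `∂_x` acting on Fourier coefficients: multiplication by `ik`. -/
def dxCoeff (c : ℤ → ℂ) (k : ℤ) : ℂ := Complex.I * (k : ℂ) * c k

/-- The operator `D^s` acting on Fourier coefficients of mean-zero periodic distributions:
multiplication by `|k|^s` for `k ≠ 0`; the zero mode is sent to `0`. -/
def fracDerivCoeff (s : ℝ) (c : ℤ → ℂ) (k : ℤ) : ℂ :=
  if k = 0 then 0 else ((|(k : ℝ)| ^ s : ℝ) : ℂ) * c k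

/-! ### The dissipation-normalized Bourgain space -/

/-- The bracket `⟨x⟩ = (1 + |x|²)^{1/2}`. -/
def bracket (x : ℝ) : ℝ := Real.sqrt (1 + |x| ^ 2)

/-- The dispersive symbol `L_k = k|k|^α`. -/
def dispSymbol (α : ℝ) (k : ℤ) : ℝ := (k : ℝ) * |(k : ℝ)| ^ α

/-- The weight of `Z^b`: `⟨k⟩^{bβ} ⟨(τ - L_k)/⟨k⟩^β⟩^b` if `-1/2 < b < 1/2`, and
`⟨k⟩^{sgn(b)β/2} ⟨(τ - L_k)/⟨k⟩^β⟩^b` otherwise. -/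
def zWeight (α β b : ℝ) (k : ℤ) (τ : ℝ) : ℝ :=
  (if -(1 / 2) < b ∧ b < 1 / 2 then bracket k ^ (b * β)
    else bracket k ^ (Real.sign b * (β / 2))) *
  bracket ((τ - dispSymbol α k) / bracket k ^ β) ^ b

/-- Distributions on `ℝ × 𝕋` that are tempered in time, given by the sequence of their spatial
Fourier coefficients, each of which is a tempered distribution in `t`. -/
abbrev SpaceTimeDist : Type := ℤ → 𝓢'(ℝ, ℂ)

/-- The Fourier transform in time of `f`, normalized as `τ ↦ ∫ f(t) e^{-itτ} dt`, is the
function `F`. (The transform `𝓕` is normalized with `e^{-2πitξ}`, whence `τ = 2πξ`.) -/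
def HasTimeFourier (f : 𝓢'(ℝ, ℂ)) (F : ℝ → ℂ) : Prop :=
  AEStronglyMeasurable F volume ∧
  ∀ φ : 𝓢(ℝ, ℂ), Integrable (fun ξ : ℝ => φ ξ * F (2 * π * ξ)) volume ∧
    (𝓕 f) φ = ∫ ξ : ℝ, φ ξ * F (2 * π * ξ)

/-- The norm of `Z^b`. It is `∞` unless `w` has vanishing zero mode (`w` has mean zero in `x`) and
all the time Fourier transforms of its spatial Fourier coefficients are functions. -/
def zNorm (α β b : ℝ) (w : SpaceTimeDist) : ℝ≥0∞ :=
  ⨅ (F : ℤ → ℝ → ℂ) (_ : w 0 = 0 ∧ ∀ k : ℤ, HasTimeFourier (w k) (F k)),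
    (∑' k : {k : ℤ // k ≠ 0},
      ∫⁻ τ : ℝ, ENNReal.ofReal (zWeight α β b k τ * ‖F k τ‖) ^ (2 : ℕ)) ^ (1 / 2 : ℝ)

/-- The space-time distribution `w` agrees for times in `[0,T]` with the time-dependent periodic
distribution whose spatial Fourier coefficients at time `t` are `f t k`. -/
def AgreesOnTime (T : ℝ) (w : SpaceTimeDist) (f : ℝ → ℤ → ℂ) : Prop :=
  ∀ k : ℤ, IntegrableOn (fun t => f t k) (Set.Ioo 0 T) volume ∧
    ∀ φ : 𝓢(ℝ, ℂ), tsupport φ ⊆ Set.Ioo 0 T →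
      w k φ = ∫ t in Set.Ioo 0 T, φ t * f t k

/-- The restricted norm `‖f‖_{Z^b_T} = inf {‖w‖_{Z^b} : w(t) ≡ f(t) for t ∈ [0,T]}` of a
time-dependent periodic distribution `f`, given by its spatial Fourier coefficients. -/
def zNormT (α β b T : ℝ) (f : ℝ → ℤ → ℂ) : ℝ≥0∞ :=
  ⨅ (w : SpaceTimeDist) (_ : AgreesOnTime T w f), zNorm α β b w

/-- The restricted norm `‖u‖_{Z^b_T}` of a time-dependent `L²(𝕋)` function. -/
def zNormTFun (α β b T : ℝ) (u : ℝ → L2Torus) : ℝ≥0∞ :=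
  zNormT α β b T (fun t => spatialCoeff (u t))

end

/-! Work with absolute values of time Fourier transforms. For b > 1/2 the reciprocal weight is
square integrable in τ uniformly in k, because ⟨k⟩^{β/2} compensates the dilation by ⟨k⟩^β. So at
each k an extension of u has an integrable profile P_k whose L¹ norm is bounded by its weighted norm
(`lintegral_le_wNorm`); its L² norm even gains ⟨k⟩^{-β/2} (`ltwo_le_wNorm`). With a cut-off equal to
1 on [0,T] and of transform κ(ξ) = Tχ(Tξ), the k-th mode of uv has on (0,T) the transform (2π)⁻¹ ∑_l
P_l * Q_{k-l} * κ, where Q belongs to v.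

Let N and n be the largest and smallest of the brackets of k, l, k-l, and put δ = b - 1/2, σ =
(α+β)/2 - 1 > 0. Each interaction is bounded in two ways.

Without a power of T (`ltwo_modeOutput_le_gain`): none of the three frequencies vanishes, so |L_k -
L_l - L_{k-l}| ≳ N^α n (`resonance_ge`). Hence the output modulation, an input modulation or the
frequency of κ is ≳ N^α n. That factor is estimated by its high-frequency gain and the others by
Young's inequality, which yields N^{-σ+(|β|+α)δ} n^{δ-1/2}.

With a power of T (`ltwo_modeOutput_le_time`): placing κ in L² gives T^{1/2}, at the cost N^{1-β/2}.

A geometric mean with a small weight on the second bound (`min_gain_le`) leaves T^{θ/2} n^{-s} with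
s = 1/2 + σ/2 and θ = δ. Since s > 1/2, the weight ⟨·⟩^{-s} is in ℓ²(ℤ), and Cauchy-Schwarz sums the
interactions whichever of k, l, k-l is smallest (`ellTwo_interaction_le`). The passage between
restricted norms and profiles is `exists_profile` and `zNormT_le`. -/

noncomputable section

/-! ### `L²` norms and convolutions of nonnegative functions -/

section LTwo

variable {X : Type*} [MeasurableSpace X] {μ : Measure X}

/-- The `L²` norm of a nonnegative function. -/
def ltwo (μ : Measure X) (f : X → ℝ≥0∞) : ℝ≥0∞ := (∫⁻ x, f x ^ 2 ∂μ) ^ (1 / 2 : ℝ)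

lemma ENNReal.rpow_half_sq (a : ℝ≥0∞) : (a ^ (1 / 2 : ℝ)) ^ 2 = a := by
  rw [← ENNReal.rpow_natCast, ← ENNReal.rpow_mul]; norm_num

lemma ENNReal.sq_rpow_half (a : ℝ≥0∞) : (a ^ 2) ^ (1 / 2 : ℝ) = a := by
  rw [← ENNReal.rpow_natCast, ← ENNReal.rpow_mul]; norm_num

lemma ltwo_sq (f : X → ℝ≥0∞) : ltwo μ f ^ 2 = ∫⁻ x, f x ^ 2 ∂μ := ENNReal.rpow_half_sq _

lemma ltwo_le_iff {f : X → ℝ≥0∞} {a : ℝ≥0∞} : ltwo μ f ≤ a ↔ ∫⁻ x, f x ^ 2 ∂μ ≤ a ^ 2 := by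
  rw [← ltwo_sq]
  exact (ENNReal.pow_le_pow_left_iff two_ne_zero).symm

lemma ltwo_mono {f g : X → ℝ≥0∞} (h : ∀ x, f x ≤ g x) : ltwo μ f ≤ ltwo μ g :=
  ENNReal.rpow_le_rpow (lintegral_mono fun x => pow_le_pow_left' (h x) 2) (by norm_num)

lemma ltwo_const_mul (c : ℝ≥0∞) {f : X → ℝ≥0∞} (hf : AEMeasurable f μ) :
    ltwo μ (fun x => c * f x) = c * ltwo μ f := by
  unfold ltwo
  simp_rw [mul_pow]
  rw [lintegral_const_mul'' _ (by fun_prop), ENNReal.mul_rpow_of_nonneg _ _ (by norm_num),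
    ENNReal.sq_rpow_half]

lemma ltwo_add_le {f g : X → ℝ≥0∞} (hf : AEMeasurable f μ) (hg : AEMeasurable g μ) :
    ltwo μ (fun x => f x + g x) ≤ ltwo μ f + ltwo μ g := by
  have := ENNReal.lintegral_Lp_add_le (p := 2) hf hg (by norm_num)
  simpa [ltwo] using this

lemma lintegral_mul_le_ltwo {f g : X → ℝ≥0∞} (hf : AEMeasurable f μ) (hg : AEMeasurable g μ) :
    ∫⁻ x, f x * g x ∂μ ≤ ltwo μ f * ltwo μ g := by
  have := ENNReal.lintegral_mul_le_Lp_mul_Lq μ Real.HolderConjugate.two_two hf hg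
  simpa [ltwo] using this

lemma ltwo_sum_le {ι : Type*} (s : Finset ι) {f : ι → X → ℝ≥0∞}
    (hf : ∀ i, AEMeasurable (f i) μ) :
    ltwo μ (fun x => ∑ i ∈ s, f i x) ≤ ∑ i ∈ s, ltwo μ (f i) := by
  classical
  induction s using Finset.induction_on with
  | empty => simp [ltwo]
  | insert i s hi ih =>
    simp only [Finset.sum_insert hi]
    refine (ltwo_add_le (hf i) (Finset.aemeasurable_fun_sum s fun i _ => hf i)).trans ?_
    gcongr

/-- Minkowski for finite sums passes to the limit by monotone convergence along the directed family
of finite subsets. -/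
lemma ltwo_tsum_le {ι : Type*} [Countable ι] {f : ι → X → ℝ≥0∞}
    (hf : ∀ i, AEMeasurable (f i) μ) :
    ltwo μ (fun x => ∑' i, f i x) ≤ ∑' i, ltwo μ (f i) := by
  classical
  rw [ltwo_le_iff]
  have h1 : ∀ x, (∑' i, f i x) ^ 2 = ⨆ s : Finset ι, (∑ i ∈ s, f i x) ^ 2 := fun x => by
    rw [ENNReal.tsum_eq_iSup_sum]
    exact (Monotone.map_iSup_of_continuousAt (f := fun a : ℝ≥0∞ => a ^ 2)
      (by fun_prop) (fun a b h => pow_le_pow_left' h 2) (by simp))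
  simp_rw [h1]
  rw [lintegral_iSup_directed (fun s => by fun_prop)]
  · refine iSup_le fun s => ?_
    rw [← ltwo_sq]
    gcongr
    exact (ltwo_sum_le s hf).trans (ENNReal.sum_le_tsum s)
  · intro s t
    refine ⟨s ∪ t, fun x => ?_, fun x => ?_⟩ <;> dsimp only
    · gcongr; exact Finset.subset_union_left
    · gcongr; exact Finset.subset_union_right

end LTwo

/-- The convolution of nonnegative functions on the line. -/
def lconv (f g : ℝ → ℝ≥0∞) (x : ℝ) : ℝ≥0∞ := ∫⁻ y, f y * g (x - y)

lemma lconv_comm (f g : ℝ → ℝ≥0∞) : lconv f g = lconv g f := by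
  funext x
  unfold lconv
  rw [← lintegral_sub_left_eq_self (fun y => f y * g (x - y)) x]
  simp [mul_comm]

@[fun_prop]
lemma measurable_lconv {f g : ℝ → ℝ≥0∞} (hf : Measurable f) (hg : Measurable g) :
    Measurable (lconv f g) := by
  unfold lconv
  exact Measurable.lintegral_prod_right' (f := fun p : ℝ × ℝ => f p.2 * g (p.1 - p.2))
    (by fun_prop)

lemma lconv_mono {f f' g g' : ℝ → ℝ≥0∞} (hf : ∀ x, f x ≤ f' x) (hg : ∀ x, g x ≤ g' x) (x : ℝ) :
    lconv f g x ≤ lconv f' g' x :=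
  lintegral_mono fun y => mul_le_mul' (hf y) (hg _)

lemma lintegral_lconv {f g : ℝ → ℝ≥0∞} (hf : Measurable f) (hg : Measurable g) :
    ∫⁻ x, lconv f g x = (∫⁻ x, f x) * ∫⁻ x, g x := by
  unfold lconv
  rw [lintegral_lintegral_swap (by fun_prop)]
  have : ∀ y, ∫⁻ x, f y * g (x - y) = f y * ∫⁻ x, g x := fun y => by
    rw [lintegral_const_mul _ (by fun_prop), lintegral_sub_right_eq_self]
  simp_rw [this]
  rw [lintegral_mul_const _ hf]

/-- Young's inequality `L¹ * L² → L²`. -/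
lemma ltwo_lconv_le {f g : ℝ → ℝ≥0∞} (hf : Measurable f) (hg : Measurable g) :
    ltwo volume (lconv f g) ≤ (∫⁻ x, f x) * ltwo volume g := by
  rw [ltwo_le_iff]
  have h1 : ∀ x, lconv f g x ^ 2 ≤ (∫⁻ y, f y) * lconv f (fun y => g y ^ 2) x := fun x => by
    -- Split f into two square roots, so that Cauchy-Schwarz gives (f * g)² ≤ ‖f‖₁ (f * g²); then
    -- integrate in x.
    have h2 : lconv f g x = ∫⁻ y, f y ^ (1 / 2 : ℝ) * (f y ^ (1 / 2 : ℝ) * g (x - y)) := by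
      refine lintegral_congr fun y => ?_
      rw [← mul_assoc, ← sq, ENNReal.rpow_half_sq]
    rw [h2]
    refine (pow_le_pow_left' (lintegral_mul_le_ltwo (by fun_prop) (by fun_prop)) 2).trans ?_
    rw [mul_pow, ltwo_sq, ltwo_sq]
    simp_rw [mul_pow, ENNReal.rpow_half_sq]
    exact le_rfl
  refine (lintegral_mono h1).trans ?_
  rw [lintegral_const_mul _ (by fun_prop), lintegral_lconv hf (by fun_prop), mul_pow, ltwo_sq]
  rw [sq, mul_assoc]

lemma ltwo_lconv_le' {f g : ℝ → ℝ≥0∞} (hf : Measurable f) (hg : Measurable g) :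
    ltwo volume (lconv f g) ≤ ltwo volume f * ∫⁻ x, g x := by
  rw [lconv_comm, mul_comm]
  exact ltwo_lconv_le hg hf

/-! ### The resonance function -/

/-- For y ≤ x, bound x^α by (x+y)^α; since y ≤ (x+y)/2 and α ≥ 1, also y^α ≤ (x+y)^α / 2. What
remains is y(x+y)^α / 2. -/
lemma resonance_pos {α x y : ℝ} (hα : 1 ≤ α) (hx : 0 < x) (hy : 0 < y) :
    1 / 2 * ((x + y) ^ α * min x y) ≤ (x + y) * (x + y) ^ α - x * x ^ α - y * y ^ α := by
  wlog hxy : y ≤ x generalizing x y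
  · have := this hy hx (le_of_not_ge hxy)
    rw [min_comm, add_comm x y]
    linarith
  rw [min_eq_right hxy]
  have h1 : x ^ α ≤ (x + y) ^ α := Real.rpow_le_rpow hx.le (by linarith) (by linarith)
  have h2 : y ^ α ≤ 1 / 2 * (x + y) ^ α := by
    have h3 : y ^ α ≤ ((x + y) * (1 / 2)) ^ α :=
      Real.rpow_le_rpow hy.le (by linarith) (by linarith)
    rw [Real.mul_rpow (by linarith) (by norm_num)] at h3
    have h4 : (1 / 2 : ℝ) ^ α ≤ (1 / 2) ^ (1 : ℝ) :=
      Real.rpow_le_rpow_of_exponent_ge (by norm_num) (by norm_num) hα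
    rw [Real.rpow_one] at h4
    have h5 : 0 ≤ (x + y) ^ α := by positivity
    nlinarith
  nlinarith

/-- The resonance function is large: `|L_{a+b} - L_a - L_b| ≳ (max |·|)^α min |·|`. -/
lemma resonance_lower {α a b : ℝ} (hα : 1 ≤ α) (ha : a ≠ 0) (hb : b ≠ 0) (hab : a + b ≠ 0) :
    1 / 2 * ((max |a + b| (max |a| |b|)) ^ α * min |a + b| (min |a| |b|)) ≤
      |(a + b) * |a + b| ^ α - a * |a| ^ α - b * |b| ^ α| := by
  -- The symbol is odd, so each sign pattern rearranges to a positive frequency z that is the sum of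
  -- two positive ones.
  have key : ∀ x y z : ℝ, 0 < x → 0 < y → z = x + y →
      1 / 2 * ((max z (max x y)) ^ α * min z (min x y)) ≤ z * z ^ α - x * x ^ α - y * y ^ α := by
    rintro x y z hx hy rfl
    have e1 : max (x + y) (max x y) = x + y := max_eq_left (max_le (by linarith) (by linarith))
    have e2 : min (x + y) (min x y) = min x y :=
      min_eq_right ((min_le_left _ _).trans (by linarith))
    rw [e1, e2]
    exact resonance_pos hα hx hy
  rcases lt_or_gt_of_ne ha with ha | ha <;> rcases lt_or_gt_of_ne hb with hb | hb
  · rw [abs_of_neg ha, abs_of_neg hb, abs_of_neg (add_neg ha hb)]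
    refine (key (-a) (-b) (-(a + b)) (by linarith) (by linarith) (by ring)).trans ?_
    refine le_trans (le_of_eq ?_) (neg_le_abs _)
    ring
  · rcases lt_or_gt_of_ne hab with hc | hc
    · rw [abs_of_neg ha, abs_of_pos hb, abs_of_neg hc]
      have := key (-(a + b)) b (-a) (by linarith) hb (by ring)
      rw [max_left_comm, min_left_comm]
      refine this.trans (le_trans (le_of_eq ?_) (le_abs_self _))
      ring
    · rw [abs_of_neg ha, abs_of_pos hb, abs_of_pos hc]
      have := key (a + b) (-a) b hc (by linarith) (by ring)
      rw [max_comm (-a), min_comm (-a), max_left_comm, min_left_comm]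
      refine this.trans (le_trans (le_of_eq ?_) (neg_le_abs _))
      ring
  · rcases lt_or_gt_of_ne hab with hc | hc
    · rw [abs_of_pos ha, abs_of_neg hb, abs_of_neg hc]
      have := key (-(a + b)) a (-b) (by linarith) ha (by ring)
      rw [max_comm a, min_comm a, max_left_comm, min_left_comm]
      refine this.trans (le_trans (le_of_eq ?_) (le_abs_self _))
      ring
    · rw [abs_of_pos ha, abs_of_neg hb, abs_of_pos hc]
      have := key (a + b) (-b) a hc (by linarith) (by ring)
      rw [max_left_comm, min_left_comm]
      refine this.trans (le_trans (le_of_eq ?_) (neg_le_abs _))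
      ring
  · rw [abs_of_pos ha, abs_of_pos hb, abs_of_pos (add_pos ha hb)]
    exact (key a b (a + b) ha hb rfl).trans (le_abs_self _)

/-! ### Brackets and weights -/

lemma one_le_bracket (x : ℝ) : 1 ≤ bracket x :=
  Real.one_le_sqrt.2 (by nlinarith [sq_nonneg |x|])

lemma bracket_pos (x : ℝ) : 0 < bracket x := zero_lt_one.trans_le (one_le_bracket x)

lemma abs_le_bracket (x : ℝ) : |x| ≤ bracket x := Real.le_sqrt_of_sq_le (by linarith)

lemma bracket_le_two_mul_abs {x : ℝ} (hx : 1 ≤ |x|) : bracket x ≤ 2 * |x| :=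
  Real.sqrt_le_iff.2 ⟨by linarith, by nlinarith⟩

lemma bracket_add_le (x y : ℝ) : bracket (x + y) ≤ bracket x + bracket y := by
  have h1 := one_le_bracket x
  have h2 := abs_le_bracket y
  refine Real.sqrt_le_iff.2 ⟨by linarith [bracket_pos y], ?_⟩
  have hx : bracket x ^ 2 = 1 + |x| ^ 2 := Real.sq_sqrt (by positivity)
  have hy : bracket y ^ 2 = 1 + |y| ^ 2 := Real.sq_sqrt (by positivity)
  have h3 := abs_add_le x y
  have h4 : |x + y| ^ 2 ≤ (|x| + |y|) ^ 2 := pow_le_pow_left₀ (abs_nonneg _) h3 2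
  nlinarith [mul_le_mul (abs_le_bracket x) h2 (abs_nonneg y) (bracket_pos x).le, bracket_pos y]

@[fun_prop]
lemma continuous_bracket : Continuous bracket := by unfold bracket; fun_prop

lemma one_le_abs_intCast {k : ℤ} (hk : k ≠ 0) : 1 ≤ |(k : ℝ)| := by
  exact_mod_cast Int.one_le_abs hk

section Brackets

variable (k l : ℤ)

/-- The largest of the brackets of the frequencies `k`, `l`, `k - l`. -/
def maxBracket : ℝ := max (bracket k) (max (bracket l) (bracket (k - l : ℤ)))

/-- The smallest of the brackets of the frequencies `k`, `l`, `k - l`. -/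
def minBracket : ℝ := min (bracket k) (min (bracket l) (bracket (k - l : ℤ)))

/-- The resonance function of the interaction of the frequencies `l`, `k - l`. -/
def resonance (α : ℝ) : ℝ := |dispSymbol α k - dispSymbol α l - dispSymbol α (k - l)|

lemma one_le_minBracket : 1 ≤ minBracket k l :=
  le_min (one_le_bracket _) (le_min (one_le_bracket _) (one_le_bracket _))

lemma minBracket_le_maxBracket : minBracket k l ≤ maxBracket k l :=
  (min_le_left _ _).trans (le_max_left _ _)

variable {k l}

/-- Nonzero integers satisfy ⟨k⟩ ≤ 2|k|. Replacing absolute values by brackets costs 2^{-α} in the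
maximum and 1/2 in the minimum, besides the 1/2 of `resonance_lower`. -/
lemma resonance_ge {α : ℝ} (hα : 1 ≤ α) (hk : k ≠ 0) (hl : l ≠ 0) (hkl : k - l ≠ 0) :
    (1 / 2) ^ (α + 2) * (maxBracket k l ^ α * minBracket k l) ≤ resonance k l α := by
  have h := resonance_lower (α := α) (a := (l : ℝ)) (b := ((k - l : ℤ) : ℝ)) hα
    (by exact_mod_cast hl) (by exact_mod_cast hkl) (by push_cast; simpa using hk)
  have e : (l : ℝ) + ((k - l : ℤ) : ℝ) = k := by push_cast; ring
  rw [e] at h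
  have h1 := bracket_le_two_mul_abs (one_le_abs_intCast hk)
  have h2 := bracket_le_two_mul_abs (one_le_abs_intCast hl)
  have h3 := bracket_le_two_mul_abs (one_le_abs_intCast hkl)
  refine le_trans ?_ h
  set N := max |(k : ℝ)| (max |(l : ℝ)| |((k - l : ℤ) : ℝ)|)
  set n := min |(k : ℝ)| (min |(l : ℝ)| |((k - l : ℤ) : ℝ)|)
  have hN : 1 / 2 * maxBracket k l ≤ N := by
    have : maxBracket k l ≤ 2 * N :=
      max_le (h1.trans (by gcongr; exact le_max_left _ _))
        (max_le (h2.trans (by gcongr; exact (le_max_left _ _).trans (le_max_right _ _)))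
          (h3.trans (by gcongr; exact (le_max_right _ _).trans (le_max_right _ _))))
    linarith
  have hn : 1 / 2 * minBracket k l ≤ n :=
    le_min (by linarith [show minBracket k l ≤ bracket k from min_le_left _ _])
      (le_min (by linarith [show minBracket k l ≤ bracket l from
          (min_le_right _ _).trans (min_le_left _ _)])
        (by linarith [show minBracket k l ≤ bracket (k - l : ℤ) from
          (min_le_right _ _).trans (min_le_right _ _)]))
  have hm := one_le_minBracket k l
  have hM := hm.trans (minBracket_le_maxBracket k l)
  have h4 : (1 / 2 * maxBracket k l) ^ α ≤ N ^ α := by gcongr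
  rw [Real.mul_rpow (by norm_num) (by linarith)] at h4
  calc (1 / 2 : ℝ) ^ (α + 2) * (maxBracket k l ^ α * minBracket k l)
      = 1 / 2 * (((1 / 2) ^ α * maxBracket k l ^ α) * (1 / 2 * minBracket k l)) := by
        rw [Real.rpow_add (by norm_num)]; norm_num; ring
    _ ≤ _ := by gcongr

end Brackets

section Weights

variable {α β b : ℝ} {k : ℤ} {τ : ℝ}

lemma zWeight_of_half_lt (hb : 1 / 2 < b) : zWeight α β b k τ =
    bracket k ^ (β / 2) * bracket ((τ - dispSymbol α k) / bracket k ^ β) ^ b := by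
  rw [zWeight, if_neg (fun h => by linarith [h.2]), Real.sign_of_pos (by linarith), one_mul]

lemma zWeight_pos : 0 < zWeight α β b k τ := by
  unfold zWeight
  have := bracket_pos k
  have := bracket_pos ((τ - dispSymbol α k) / bracket k ^ β)
  split_ifs <;> positivity

@[fun_prop]
lemma continuous_zWeight : Continuous (zWeight α β b k) := by
  unfold zWeight
  have : ∀ τ, bracket ((τ - dispSymbol α k) / bracket k ^ β) ≠ 0 := fun τ => (bracket_pos _).ne'
  refine continuous_const.mul (Continuous.rpow_const (by fun_prop) fun τ => Or.inl (this τ))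

lemma le_zWeight (hb : 1 / 2 < b) : bracket k ^ (β / 2) ≤ zWeight α β b k τ := by
  rw [zWeight_of_half_lt hb]
  exact le_mul_of_one_le_right (Real.rpow_nonneg (bracket_pos _).le _)
    (Real.one_le_rpow (one_le_bracket _) (by linarith))

lemma le_bracket_modulation {R : ℝ} (hτ : R ≤ |τ - dispSymbol α k|) :
    R / bracket k ^ β ≤ bracket ((τ - dispSymbol α k) / bracket k ^ β) := by
  have hJ := bracket_pos k
  refine le_trans ?_ (abs_le_bracket _)
  rw [abs_div, abs_of_pos (Real.rpow_pos_of_pos hJ β)]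
  gcongr

lemma le_zWeight_of_le {R : ℝ} (hb : 1 / 2 < b) (hR : 0 < R) (hτ : R ≤ |τ - dispSymbol α k|) :
    bracket k ^ (-(β * (b - 1 / 2))) * R ^ b ≤ zWeight α β b k τ := by
  have hJ := bracket_pos k
  rw [zWeight_of_half_lt hb]
  calc bracket k ^ (-(β * (b - 1 / 2))) * R ^ b
      = bracket k ^ (β / 2) * (R / bracket k ^ β) ^ b := by
        rw [Real.div_rpow hR.le (by positivity), ← Real.rpow_mul hJ.le,
          show -(β * (b - 1 / 2)) = β / 2 - β * b by ring, Real.rpow_sub hJ]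
        field_simp
    _ ≤ _ := by
        gcongr
        exact le_bracket_modulation hτ

/-- The multiplier by which the product is measured. -/
def outWeight (α β b : ℝ) (k : ℤ) (τ : ℝ) : ℝ :=
  zWeight α β (b - 1) k τ * (|(k : ℝ)| ^ (-(β * (b - 1 / 2))) * |(k : ℝ)|)

/-- The derivatives contribute |k|^{1-β(b-1/2)} and the weight ⟨k⟩^{(b-1)β}; the dependence on b
cancels and leaves 1 - β/2. The bound β ≤ 1 keeps the first exponent nonnegative, so |k| may be
replaced by ⟨k⟩. -/
lemma outWeight_le_of_bracket {ρ : ℝ} (hβ : β ≤ 1) (hb : 1 / 2 < b) (hb' : b < 1) (hk : k ≠ 0)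
    (hρ : 0 < ρ) (h : ρ ≤ bracket ((τ - dispSymbol α k) / bracket k ^ β)) :
    outWeight α β b k τ ≤ bracket k ^ (1 - β / 2) * ρ ^ (b - 1) := by
  have hJ := bracket_pos k
  have hk1 := one_le_abs_intCast hk
  have hk0 : 0 < |(k : ℝ)| := by linarith
  have e : |(k : ℝ)| ^ (-(β * (b - 1 / 2))) * |(k : ℝ)| = |(k : ℝ)| ^ (1 - β * (b - 1 / 2)) := by
    rw [show 1 - β * (b - 1 / 2) = -(β * (b - 1 / 2)) + 1 by ring, Real.rpow_add_one hk0.ne']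
  have h1 : |(k : ℝ)| ^ (1 - β * (b - 1 / 2)) ≤ bracket k ^ (1 - β * (b - 1 / 2)) :=
    Real.rpow_le_rpow hk0.le (abs_le_bracket _) (by nlinarith)
  have h2 : bracket ((τ - dispSymbol α k) / bracket k ^ β) ^ (b - 1) ≤ ρ ^ (b - 1) :=
    Real.rpow_le_rpow_of_nonpos hρ h (by linarith)
  -- Here -1/2 < b - 1 < 0, so the first branch of the weight applies.
  rw [outWeight, e, zWeight, if_pos ⟨by linarith, by linarith⟩]
  calc _ ≤ (bracket k ^ ((b - 1) * β) * ρ ^ (b - 1)) * bracket k ^ (1 - β * (b - 1 / 2)) := by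
        gcongr
    _ = _ := by
        rw [mul_right_comm, ← Real.rpow_add hJ]
        congr 2; ring

lemma outWeight_le (hβ : β ≤ 1) (hb : 1 / 2 < b) (hb' : b < 1) (hk : k ≠ 0) :
    outWeight α β b k τ ≤ bracket k ^ (1 - β / 2) := by
  simpa using outWeight_le_of_bracket (α := α) (τ := τ) hβ hb hb' hk one_pos (one_le_bracket _)

lemma outWeight_le_of_le {R : ℝ} (hβ : β ≤ 1) (hb : 1 / 2 < b) (hb' : b < 1) (hk : k ≠ 0)
    (hR : 0 < R) (hτ : R ≤ |τ - dispSymbol α k|) :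
    outWeight α β b k τ ≤ bracket k ^ (1 - β * (b - 1 / 2)) * R ^ (b - 1) := by
  have hJ := bracket_pos k
  refine (outWeight_le_of_bracket hβ hb hb' hk (by positivity)
    (le_bracket_modulation hτ)).trans (le_of_eq ?_)
  rw [Real.div_rpow hR.le (by positivity), ← Real.rpow_mul hJ.le,
    show 1 - β * (b - 1 / 2) = (1 - β / 2) - β * (b - 1) by ring, Real.rpow_sub hJ _ (β * (b - 1))]
  field_simp

end Weights

/-! ### Bounds for functions with finite weighted norm -/

lemma lintegral_comp_mul_left_real {a : ℝ} (ha : a ≠ 0) (f : ℝ → ℝ≥0∞) :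
    ∫⁻ x, f (a * x) = ENNReal.ofReal |a⁻¹| * ∫⁻ x, f x := by
  rw [← smul_eq_mul, ← lintegral_smul_measure, ← Real.map_volume_mul_left ha]
  exact (lintegral_map_equiv f (Homeomorph.mulLeft₀ a ha).toMeasurableEquiv).symm

lemma lintegral_comp_mul_sub_real {a : ℝ} (ha : a ≠ 0) (c : ℝ) (f : ℝ → ℝ≥0∞) :
    ∫⁻ x, f (a * x - c) = ENNReal.ofReal |a⁻¹| * ∫⁻ x, f x := by
  rw [lintegral_comp_mul_left_real ha (fun x => f (x - c)), lintegral_sub_right_eq_self]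

/-- The weighted `L²` norm in frequency `ξ = τ / 2π` at spatial frequency `k`. -/
def wNorm (α β b : ℝ) (k : ℤ) (P : ℝ → ℝ≥0∞) : ℝ≥0∞ :=
  ltwo volume (fun ξ => ENNReal.ofReal (zWeight α β b k (2 * π * ξ)) * P ξ)

/-- The `L²` norm of `⟨·⟩^{-b}`. -/
def bracketNorm (b : ℝ) : ℝ≥0∞ := ltwo volume (fun s => ENNReal.ofReal (bracket s ^ (-b)))

lemma bracketNorm_lt_top {b : ℝ} (hb : 1 / 2 < b) : bracketNorm b < ⊤ := by
  have h := integrable_rpow_neg_one_add_norm_sq (E := ℝ) (μ := volume) (r := 2 * b)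
    (by simp; linarith)
  refine ENNReal.rpow_lt_top_of_nonneg (by norm_num) ?_
  refine ne_of_lt (lt_of_le_of_lt (le_of_eq ?_) h.lintegral_lt_top)
  refine lintegral_congr fun s => ?_
  rw [← ENNReal.ofReal_pow (Real.rpow_nonneg (bracket_pos _).le _)]
  congr 1
  have h1 : 0 ≤ 1 + |s| ^ 2 := by positivity
  rw [bracket, Real.sqrt_eq_rpow, ← Real.rpow_mul h1, ← Real.rpow_mul_natCast h1, Real.norm_eq_abs]
  congr 1
  push_cast; ring

section

variable {α β b : ℝ} {k : ℤ} {P : ℝ → ℝ≥0∞}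

/-- The substitution s = (2πξ - L_k)/⟨k⟩^β has Jacobian ⟨k⟩^β/(2π), and ⟨k⟩^β cancels the squared
prefactor ⟨k⟩^{-β}. Hence the bound is uniform in k. -/
lemma ltwo_inv_zWeight (hb : 1 / 2 < b) :
    ltwo volume (fun ξ => ENNReal.ofReal (zWeight α β b k (2 * π * ξ))⁻¹) ≤ bracketNorm b := by
  have hJ := bracket_pos k
  have hJβ : 0 < bracket k ^ β := Real.rpow_pos_of_pos hJ β
  rw [ltwo_le_iff, bracketNorm, ltwo_sq]
  have ha : 2 * π / bracket k ^ β ≠ 0 := by positivity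
  have e : ∀ ξ : ℝ, ENNReal.ofReal (zWeight α β b k (2 * π * ξ))⁻¹ ^ 2 =
      ENNReal.ofReal (bracket k ^ β)⁻¹ * (ENNReal.ofReal
        (bracket (2 * π / bracket k ^ β * ξ - dispSymbol α k / bracket k ^ β) ^ (-b))) ^ 2 := by
    intro ξ
    have h0 := bracket_pos ((2 * π * ξ - dispSymbol α k) / bracket k ^ β)
    rw [zWeight_of_half_lt hb, mul_inv, ENNReal.ofReal_mul (by positivity), mul_pow,
      ← Real.rpow_neg h0.le, ← ENNReal.ofReal_pow (by positivity)]
    congr 2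
    · rw [← Real.rpow_neg hJ.le, ← Real.rpow_mul_natCast hJ.le, ← Real.rpow_neg hJ.le]
      congr 1; push_cast; ring
    · congr 3
      rw [sub_div]; ring
  simp_rw [e]
  rw [lintegral_const_mul' _ _ ENNReal.ofReal_ne_top,
    lintegral_comp_mul_sub_real ha _ (fun x => ENNReal.ofReal (bracket x ^ (-b)) ^ 2), ← mul_assoc,
    ← ENNReal.ofReal_mul (by positivity), abs_of_pos (by positivity)]
  refine mul_le_of_le_one_left' (ENNReal.ofReal_le_one.2 ?_)
  rw [inv_div, inv_mul_eq_div, div_div_cancel_left' hJβ.ne']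
  exact inv_le_one_of_one_le₀ (by linarith [Real.pi_gt_three])

/-- Cauchy-Schwarz against the reciprocal weight; this is where b > 1/2 gives integrable profiles.
-/
lemma lintegral_le_wNorm (hb : 1 / 2 < b) (hP : Measurable P) :
    ∫⁻ ξ, P ξ ≤ bracketNorm b * wNorm α β b k P := by
  have e : ∀ ξ, P ξ = ENNReal.ofReal (zWeight α β b k (2 * π * ξ))⁻¹ *
      (ENNReal.ofReal (zWeight α β b k (2 * π * ξ)) * P ξ) := fun ξ => by
    rw [← mul_assoc, ← ENNReal.ofReal_mul (inv_pos.2 zWeight_pos).le,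
      inv_mul_cancel₀ zWeight_pos.ne', ENNReal.ofReal_one, one_mul]
  have hm : Measurable fun ξ => zWeight α β b k (2 * π * ξ) :=
    (continuous_zWeight.comp (by fun_prop)).measurable
  rw [lintegral_congr e]
  refine (lintegral_mul_le_ltwo (by fun_prop) (by fun_prop)).trans ?_
  exact mul_le_mul' (ltwo_inv_zWeight hb) le_rfl

lemma ltwo_le_mul_wNorm {Q : ℝ → ℝ≥0∞} {c : ℝ} (hP : Measurable P) (hc : 0 < c)
    (h : ∀ ξ, Q ξ ≠ 0 → Q ξ = P ξ ∧ c ≤ zWeight α β b k (2 * π * ξ)) :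
    ltwo volume Q ≤ ENNReal.ofReal c⁻¹ * wNorm α β b k P := by
  have hm : Measurable fun ξ => zWeight α β b k (2 * π * ξ) :=
    (continuous_zWeight.comp (by fun_prop)).measurable
  rw [wNorm, ← ltwo_const_mul _ (by fun_prop)]
  refine ltwo_mono fun ξ => ?_
  by_cases h0 : Q ξ = 0
  · simp [h0]
  obtain ⟨h1, h2⟩ := h ξ h0
  rw [h1, ← mul_assoc, ← ENNReal.ofReal_mul (by positivity)]
  refine le_mul_of_one_le_left' (ENNReal.one_le_ofReal.2 ?_)
  rw [inv_mul_eq_div]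
  exact (one_le_div hc).2 h2

lemma ltwo_le_wNorm (hb : 1 / 2 < b) (hP : Measurable P) :
    ltwo volume P ≤ ENNReal.ofReal (bracket k ^ (-(β / 2))) * wNorm α β b k P := by
  have hJ := bracket_pos k
  rw [Real.rpow_neg hJ.le]
  exact ltwo_le_mul_wNorm hP (by positivity) fun ξ _ => ⟨rfl, le_zWeight hb⟩

/-- The part of `P` with modulation at least `R`. -/
def highModulation (α : ℝ) (k : ℤ) (R : ℝ) (P : ℝ → ℝ≥0∞) : ℝ → ℝ≥0∞ :=
  {ξ : ℝ | R ≤ |2 * π * ξ - dispSymbol α k|}.indicator P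

lemma measurable_highModulation {R : ℝ} (hP : Measurable P) :
    Measurable (highModulation α k R P) :=
  hP.indicator (measurableSet_le measurable_const (by fun_prop))

lemma ltwo_highModulation_le {R : ℝ} (hb : 1 / 2 < b) (hR : 0 < R) (hP : Measurable P) :
    ltwo volume (highModulation α k R P) ≤
      ENNReal.ofReal (bracket k ^ (β * (b - 1 / 2)) * R ^ (-b)) * wNorm α β b k P := by
  have hJ := bracket_pos k
  have e : bracket k ^ (β * (b - 1 / 2)) * R ^ (-b) =
      (bracket k ^ (-(β * (b - 1 / 2))) * R ^ b)⁻¹ := by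
    rw [mul_inv, ← Real.rpow_neg hJ.le, ← Real.rpow_neg hR.le, neg_neg]
  rw [e]
  refine ltwo_le_mul_wNorm hP (by positivity) fun ξ hξ => ?_
  have hmem := Set.mem_of_indicator_ne_zero hξ
  exact ⟨Set.indicator_of_mem hmem _, le_zWeight_of_le hb hR hmem⟩

end

/-! ### The rescaled time cut-off -/

/-- The `L¹`-invariant rescaling `ξ ↦ T K(Tξ)`. -/
def rescale (T : ℝ) (K : ℝ → ℝ≥0∞) (ξ : ℝ) : ℝ≥0∞ := ENNReal.ofReal T * K (T * ξ)

section

variable {T R : ℝ} {K : ℝ → ℝ≥0∞}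

@[fun_prop]
lemma measurable_rescale (hK : Measurable K) : Measurable (rescale T K) := by
  unfold rescale; fun_prop

lemma lintegral_rescale (hT : 0 < T) : ∫⁻ ξ, rescale T K ξ = ∫⁻ ξ, K ξ := by
  unfold rescale
  rw [lintegral_const_mul' _ _ ENNReal.ofReal_ne_top, lintegral_comp_mul_left_real hT.ne',
    ← mul_assoc, ← ENNReal.ofReal_mul hT.le, abs_of_pos (inv_pos.2 hT), mul_inv_cancel₀ hT.ne',
    ENNReal.ofReal_one, one_mul]

lemma ltwo_rescale (hT : 0 < T) :
    ltwo volume (rescale T K) = ENNReal.ofReal (T ^ (1 / 2 : ℝ)) * ltwo volume K := by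
  unfold ltwo rescale
  simp_rw [mul_pow]
  rw [lintegral_const_mul' _ _ (by finiteness),
    lintegral_comp_mul_left_real hT.ne' (fun x => K x ^ 2),
    ← mul_assoc, ← ENNReal.ofReal_pow hT.le, ← ENNReal.ofReal_mul (by positivity),
    abs_of_pos (inv_pos.2 hT), sq, mul_assoc, mul_inv_cancel₀ hT.ne', mul_one,
    ENNReal.mul_rpow_of_nonneg _ _ (by norm_num), ENNReal.ofReal_rpow_of_pos hT]

/-- The region |2πξ| ≥ R costs R^{-1/2} against the weight |2πξ|^{1/2}, and that weighted L² norm is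
invariant under ξ ↦ T K(Tξ). The bound is therefore independent of T. -/
lemma ltwo_indicator_rescale_le (hT : 0 < T) (hR : 0 < R) :
    ltwo volume ({ξ : ℝ | R ≤ |2 * π * ξ|}.indicator (rescale T K)) ≤
      ENNReal.ofReal (R ^ (-(1 / 2) : ℝ)) *
        ltwo volume (fun ξ => ENNReal.ofReal (|2 * π * ξ| ^ (1 / 2 : ℝ)) * K ξ) := by
  rw [ltwo_le_iff, mul_pow, ltwo_sq]
  have h1 : ∀ ξ, ({ξ : ℝ | R ≤ |2 * π * ξ|}.indicator (rescale T K) ξ) ^ 2 ≤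
      ENNReal.ofReal (R⁻¹ * T) *
        (ENNReal.ofReal (|2 * π * (T * ξ)| ^ (1 / 2 : ℝ)) * K (T * ξ)) ^ 2 := by
    intro ξ
    by_cases hξ : ξ ∈ {ξ : ℝ | R ≤ |2 * π * ξ|}
    · rw [Set.indicator_of_mem hξ, rescale, mul_pow, mul_pow, ← mul_assoc,
        ← ENNReal.ofReal_pow hT.le, ← ENNReal.ofReal_pow (by positivity),
        ← ENNReal.ofReal_mul (by positivity)]
      gcongr
      rw [← Real.rpow_mul_natCast (abs_nonneg _)]
      norm_num [abs_mul]
      rw [abs_of_pos hT, abs_of_pos Real.pi_pos]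
      have : R ≤ 2 * π * |ξ| := by
        have := hξ.out
        rwa [abs_mul, abs_of_pos Real.two_pi_pos] at this
      rw [show R⁻¹ * T * (2 * π * (T * |ξ|)) = T ^ 2 * ((2 * π * |ξ|) / R) by field_simp]
      exact le_mul_of_one_le_right (by positivity) ((one_le_div hR).2 this)
    · rw [Set.indicator_of_notMem hξ]; simp
  refine (lintegral_mono h1).trans ?_
  rw [lintegral_const_mul' _ _ ENNReal.ofReal_ne_top, lintegral_comp_mul_left_real hT.ne'
    (fun x => (ENNReal.ofReal (|2 * π * x| ^ (1 / 2 : ℝ)) * K x) ^ 2), ← mul_assoc]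
  gcongr
  rw [← ENNReal.ofReal_mul (by positivity), ← ENNReal.ofReal_pow (by positivity)]
  refine ENNReal.ofReal_le_ofReal (le_of_eq ?_)
  rw [← Real.rpow_mul_natCast hR.le, abs_of_pos (by positivity)]
  norm_num [Real.rpow_neg_one]
  field_simp

end

/-! ### The interaction of two spatial frequencies -/

/-! ### Exponent arithmetic for one interaction -/

section RealBounds

variable {α β δ c N n J J₁ R : ℝ}

/-- The frequency factor gained from the resonance. -/
def gain (α β δ N n : ℝ) : ℝ :=
  N ^ (1 - β / 2 - α / 2 + (|β| + α) * δ) * n ^ (δ - 1 / 2)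

/-- Since r ≥ -1 and c ≤ 1, the constant c^r is at most c⁻¹, whatever r is. -/
lemma rpow_le_of_resonance {r : ℝ} (hr : r ≤ 0) (hr' : -1 ≤ r) (hc : 0 < c) (hc' : c ≤ 1)
    (hn : 1 ≤ n) (hN : 1 ≤ N) (hR : c * (N ^ α * n) ≤ R) :
    R ^ r ≤ c⁻¹ * (N ^ (α * r) * n ^ r) := by
  have h0 : 0 < N := by linarith
  have h1 : 0 < n := by linarith
  calc R ^ r ≤ (c * (N ^ α * n)) ^ r := Real.rpow_le_rpow_of_nonpos (by positivity) hR hr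
    _ = c ^ r * (N ^ (α * r) * n ^ r) := by
        rw [Real.mul_rpow hc.le (by positivity), Real.mul_rpow (by positivity) h1.le,
          ← Real.rpow_mul h0.le]
    _ ≤ _ := by
        gcongr
        rw [← Real.rpow_neg_one]
        exact Real.rpow_le_rpow_of_exponent_ge hc hc' hr'

/-- The case of an input of bracket J₁ with modulation at least R. The true exponents are better
than those of `gain`, which are weakened to serve all cases. -/
lemma gain_bound_input (hα : 1 < α) (hβ : β ≤ 1) (hδ : 0 < δ) (hδ' : δ < 1 / 2) (hc : 0 < c)
    (hc' : c ≤ 1) (hn : 1 ≤ n) (hN : 1 ≤ N) (hJ : 1 ≤ J) (hJN : J ≤ N) (hJ₁ : 1 ≤ J₁)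
    (hJ₁N : J₁ ≤ N) (hR : c * (N ^ α * n) ≤ R) :
    J ^ (1 - β / 2) * (J₁ ^ (β * δ) * R ^ (-(1 / 2 + δ))) ≤ c⁻¹ * gain α β δ N n := by
  have h0 : 0 < N := by linarith
  have h1 : 0 < n := by linarith
  have h2 := rpow_le_of_resonance (r := -(1 / 2 + δ)) (by linarith) (by linarith) hc hc' hn hN hR
  have hR0 : 0 < R := lt_of_lt_of_le (by positivity) hR
  have h3 : J₁ ^ (β * δ) ≤ N ^ (|β| * δ) := calc
    J₁ ^ (β * δ) ≤ J₁ ^ (|β| * δ) :=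
      Real.rpow_le_rpow_of_exponent_le hJ₁ (by gcongr; exact le_abs_self β)
    _ ≤ _ := by gcongr
  have h4 : J ^ (1 - β / 2) ≤ N ^ (1 - β / 2) :=
    Real.rpow_le_rpow (by linarith) hJN (by linarith)
  calc J ^ (1 - β / 2) * (J₁ ^ (β * δ) * R ^ (-(1 / 2 + δ)))
      ≤ N ^ (1 - β / 2) * (N ^ (|β| * δ) *
          (c⁻¹ * (N ^ (α * -(1 / 2 + δ)) * n ^ (-(1 / 2 + δ))))) := by gcongr
    _ = c⁻¹ * (N ^ (1 - β / 2 + |β| * δ + α * -(1 / 2 + δ)) * n ^ (-(1 / 2 + δ))) := by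
        rw [Real.rpow_add h0, Real.rpow_add h0]; ring
    _ ≤ _ := by
        unfold gain
        refine mul_le_mul_of_nonneg_left (mul_le_mul (Real.rpow_le_rpow_of_exponent_le hN ?_)
          (Real.rpow_le_rpow_of_exponent_le hn ?_) (by positivity) (by positivity)) (by positivity)
        · nlinarith
        · linarith

/-- The case in which the cut-off carries the high frequency. -/
lemma gain_bound_cutoff (hα : 1 < α) (hβ : β ≤ 1) (hδ : 0 < δ) (hc : 0 < c)
    (hc' : c ≤ 1) (hn : 1 ≤ n) (hN : 1 ≤ N) (hJ : 1 ≤ J) (hJN : J ≤ N)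
    (hR : c * (N ^ α * n) ≤ R) :
    J ^ (1 - β / 2) * R ^ (-(1 / 2) : ℝ) ≤ c⁻¹ * gain α β δ N n := by
  have h0 : 0 < N := by linarith
  have h1 : 0 < n := by linarith
  have h2 := rpow_le_of_resonance (r := -(1 / 2)) (by linarith) (by linarith) hc hc' hn hN hR
  have h4 : J ^ (1 - β / 2) ≤ N ^ (1 - β / 2) :=
    Real.rpow_le_rpow (by linarith) hJN (by linarith)
  have hR0 : 0 < R := lt_of_lt_of_le (by positivity) hR
  calc J ^ (1 - β / 2) * R ^ (-(1 / 2) : ℝ)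
      ≤ N ^ (1 - β / 2) * (c⁻¹ * (N ^ (α * -(1 / 2)) * n ^ (-(1 / 2) : ℝ))) := by gcongr
    _ = c⁻¹ * (N ^ (1 - β / 2 + α * -(1 / 2)) * n ^ (-(1 / 2) : ℝ)) := by
        rw [Real.rpow_add h0]; ring
    _ ≤ _ := by
        unfold gain
        refine mul_le_mul_of_nonneg_left (mul_le_mul (Real.rpow_le_rpow_of_exponent_le hN ?_)
          (Real.rpow_le_rpow_of_exponent_le hn ?_) (by positivity) (by positivity)) (by positivity)
        · nlinarith [mul_nonneg (add_nonneg (abs_nonneg β) (by linarith : 0 ≤ α)) hδ.le]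
        · linarith

/-- The case of large output modulation, which dictates the exponents of `gain`. J₁ is the larger
input bracket, comparable to N, so its L² gain is worth N^{-β/2} up to 2^{|β|}, for either sign of
β. -/
lemma gain_bound_output (hδ : 0 < δ) (hδ' : δ < 1 / 2) (hc : 0 < c)
    (hc' : c ≤ 1) (hn : 1 ≤ n) (hN : 1 ≤ N) (hJ : 1 ≤ J) (hJN : J ≤ N) (hJ₁ : N ≤ 2 * J₁)
    (hJ₁N : J₁ ≤ N) (hR : c * (N ^ α * n) ≤ R) :
    J ^ (1 - β * δ) * R ^ (δ - 1 / 2) * J₁ ^ (-(β / 2)) ≤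
      (c⁻¹ * 2 ^ |β|) * gain α β δ N n := by
  have h0 : 0 < N := by linarith
  have h1 : 0 < n := by linarith
  have hJ₁0 : 0 < J₁ := by linarith
  have h2 := rpow_le_of_resonance (r := δ - 1 / 2) (by linarith) (by linarith) hc hc' hn hN hR
  have h3 : J₁ ^ (-(β / 2)) ≤ 2 ^ |β| * N ^ (-(β / 2)) := by
    rcases le_total 0 β with hb | hb
    · calc J₁ ^ (-(β / 2)) ≤ (2⁻¹ * N) ^ (-(β / 2)) :=
            Real.rpow_le_rpow_of_nonpos (by positivity) (by linarith) (by linarith)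
        _ = 2 ^ (β / 2) * N ^ (-(β / 2)) := by
            rw [Real.mul_rpow (by norm_num) h0.le, Real.inv_rpow (by norm_num),
              Real.rpow_neg (by norm_num), inv_inv]
        _ ≤ _ := by
            gcongr
            · norm_num
            · linarith [le_abs_self β]
    · calc J₁ ^ (-(β / 2)) ≤ N ^ (-(β / 2)) :=
            Real.rpow_le_rpow hJ₁0.le hJ₁N (by linarith)
        _ ≤ _ := le_mul_of_one_le_left (by positivity)
            (Real.one_le_rpow (by norm_num) (abs_nonneg β))
  have h4 : J ^ (1 - β * δ) ≤ N ^ (1 + |β| * δ) := calc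
    J ^ (1 - β * δ) ≤ J ^ (1 + |β| * δ) :=
      Real.rpow_le_rpow_of_exponent_le hJ (by nlinarith [neg_abs_le β])
    _ ≤ _ := by gcongr
  have hR0 : 0 < R := lt_of_lt_of_le (by positivity) hR
  calc J ^ (1 - β * δ) * R ^ (δ - 1 / 2) * J₁ ^ (-(β / 2))
      ≤ N ^ (1 + |β| * δ) * (c⁻¹ * (N ^ (α * (δ - 1 / 2)) * n ^ (δ - 1 / 2))) *
          (2 ^ |β| * N ^ (-(β / 2))) := by gcongr
    _ = (c⁻¹ * 2 ^ |β|) *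
          (N ^ (1 + |β| * δ + α * (δ - 1 / 2) + -(β / 2)) * n ^ (δ - 1 / 2)) := by
        rw [Real.rpow_add h0 _ (-(β / 2)), Real.rpow_add h0 _ (α * (δ - 1 / 2))]; ring
    _ = _ := by
        unfold gain
        congr 3; ring

lemma min_le_rpow_mul_rpow {x y θ : ℝ} (hx : 0 < x) (hy : 0 < y) (hθ : 0 ≤ θ) (hθ' : θ ≤ 1) :
    min x y ≤ x ^ (1 - θ) * y ^ θ := by
  have h : 0 < min x y := lt_min hx hy
  calc min x y = min x y ^ (1 - θ) * min x y ^ θ := by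
        rw [← Real.rpow_add h]; simp
    _ ≤ _ := mul_le_mul (Real.rpow_le_rpow h.le (min_le_left _ _) (by linarith))
        (Real.rpow_le_rpow h.le (min_le_right _ _) hθ) (by positivity) (by positivity)

/-- The small parameter: `b = 1/2 + θ` and the power of `T` is `θ / 2`. -/
def smallParam (α β : ℝ) : ℝ :=
  ((α + β) / 2 - 1) / (2 * (|β| + α + ((α + β) / 2 - 1) + (1 - β / 2) + 2))

lemma smallParam_pos (hα : 1 < α) (hαβ : 2 - α < β) : 0 < smallParam α β := by
  have := abs_nonneg β
  unfold smallParam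
  apply div_pos <;> linarith

lemma smallParam_lt (hα : 1 < α) (hβ : β ≤ 1) : smallParam α β < 1 / 2 := by
  have := abs_nonneg β
  unfold smallParam
  rw [div_lt_iff₀ (by linarith)]
  linarith

/-- Take the geometric mean with weights 1 - θ and θ. The exponent of N stays negative, so N may be
lowered to n, which turns the decay in N into the part of the n-exponent beyond 1/2. -/
lemma min_gain_le (hα : 1 < α) (hαβ : 2 - α < β) (hβ : β ≤ 1) (hn : 1 ≤ n) (hnN : n ≤ N)
    {T : ℝ} (hT : 0 < T) :
    min (gain α β (smallParam α β) N n) (N ^ (1 - β / 2) * T ^ (1 / 2 : ℝ)) ≤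
      T ^ (smallParam α β / 2) * n ^ (-(1 / 2 + ((α + β) / 2 - 1) / 2)) := by
  have hθ := smallParam_pos hα hαβ
  have hθ' := smallParam_lt hα hβ
  -- This choice of θ makes all losses in the exponent of N, together with a reserve 2θ, use exactly
  -- half of σ. The reserve pays for the 3θ/2 lost in the exponent of n.
  have hK : smallParam α β * (|β| + α + ((α + β) / 2 - 1) + (1 - β / 2) + 2) =
      ((α + β) / 2 - 1) / 2 := by
    have := abs_nonneg β
    unfold smallParam
    rw [div_mul_eq_mul_div, div_eq_div_iff (by linarith) (by norm_num)]
    ring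
  set θ := smallParam α β
  have h0 : 0 < n := by linarith
  have h1 : 0 < N := by linarith
  have hb := abs_nonneg β
  refine (min_le_rpow_mul_rpow (θ := θ) (by unfold gain; positivity) (by positivity) hθ.le
    (by linarith)).trans ?_
  have e : gain α β θ N n ^ (1 - θ) * (N ^ (1 - β / 2) * T ^ (1 / 2 : ℝ)) ^ θ =
      T ^ (θ / 2) * (N ^ ((1 - β / 2 - α / 2 + (|β| + α) * θ) * (1 - θ) + (1 - β / 2) * θ) *
        n ^ ((θ - 1 / 2) * (1 - θ))) := by
    unfold gain
    rw [Real.mul_rpow (by positivity) (by positivity), Real.mul_rpow (by positivity)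
      (by positivity), ← Real.rpow_mul h1.le, ← Real.rpow_mul h1.le, ← Real.rpow_mul h0.le,
      ← Real.rpow_mul hT.le, Real.rpow_add h1]
    rw [show 1 / 2 * θ = θ / 2 by ring]
    ring
  rw [e]
  have hexp : (1 - β / 2 - α / 2 + (|β| + α) * θ) * (1 - θ) + (1 - β / 2) * θ ≤
      -((α + β) / 2 - 1) / 2 - 2 * θ := by
    have : 0 ≤ (|β| + α) * θ * θ := by positivity
    nlinarith
  gcongr
  calc _ ≤ N ^ (-((α + β) / 2 - 1) / 2 - 2 * θ) * n ^ ((θ - 1 / 2) * (1 - θ)) := by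
        gcongr
        linarith
    _ ≤ n ^ (-((α + β) / 2 - 1) / 2 - 2 * θ) * n ^ ((θ - 1 / 2) * (1 - θ)) := by
        gcongr ?_ * _
        exact Real.rpow_le_rpow_of_nonpos h0 hnN (by linarith)
    _ = n ^ (-((α + β) / 2 - 1) / 2 - 2 * θ + (θ - 1 / 2) * (1 - θ)) := by
        rw [Real.rpow_add h0]
    _ ≤ _ := by
        apply Real.rpow_le_rpow_of_exponent_le hn
        nlinarith [sq_nonneg θ]

end RealBounds

/-! ### Convolution estimates for one pair of frequencies -/

section SingleMode

variable {α β b T : ℝ} {k l : ℤ} {p q κ : ℝ → ℝ≥0∞}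

lemma lconv_lconv_eq (hp : Measurable p) (hq : Measurable q) (ξ : ℝ) :
    lconv (lconv p q) κ ξ = ∫⁻ y, ∫⁻ x, p x * q (y - x) * κ (ξ - y) := by
  unfold lconv
  refine lintegral_congr fun y => ?_
  rw [lintegral_mul_const _ (by fun_prop)]

/-- If the output has small modulation, one of the three factors has large modulation. -/
lemma lconv_lconv_le_of_lt (hp : Measurable p) (hq : Measurable q) (hκ : Measurable κ) {ξ R : ℝ}
    (hR : 4 * R ≤ resonance k l α) (hξ : |2 * π * ξ - dispSymbol α k| < R) :
    lconv (lconv p q) κ ξ ≤ lconv (lconv (highModulation α l R p) q) κ ξ +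
      lconv (lconv p (highModulation α (k - l) R q)) κ ξ +
      lconv (lconv p q) ({ξ : ℝ | R ≤ |2 * π * ξ|}.indicator κ) ξ := by
  have hp' : Measurable (highModulation α l R p) := measurable_highModulation hp
  have hq' : Measurable (highModulation α (k - l) R q) := measurable_highModulation hq
  have hκ' : Measurable ({ξ : ℝ | R ≤ |2 * π * ξ|}.indicator κ) :=
    hκ.indicator (measurableSet_le measurable_const (by fun_prop))
  rw [lconv_lconv_eq hp hq, lconv_lconv_eq hp' hq, lconv_lconv_eq hp hq', lconv_lconv_eq hp hq]
  have hm : ∀ {f g h : ℝ → ℝ≥0∞}, Measurable f → Measurable g → Measurable h →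
      Measurable fun y => ∫⁻ x, f x * g (y - x) * h (ξ - y) := by
    intro f g h hf hg hh
    exact Measurable.lintegral_prod_right'
      (f := fun z : ℝ × ℝ => f z.2 * g (z.1 - z.2) * h (ξ - z.1)) (by fun_prop)
  rw [← lintegral_add_left (hm hp' hq hκ), ← lintegral_add_left (by
    exact (hm hp' hq hκ).add (hm hp hq' hκ))]
  refine lintegral_mono fun y => ?_
  dsimp only
  rw [← lintegral_add_left (by fun_prop), ← lintegral_add_left (by fun_prop)]
  refine lintegral_mono fun x => ?_
  dsimp only
  by_cases h1 : R ≤ |2 * π * x - dispSymbol α l|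
  · have : highModulation α l R p x = p x :=
      Set.indicator_of_mem (s := {ξ : ℝ | R ≤ |2 * π * ξ - dispSymbol α l|}) h1 p
    rw [this, add_assoc]
    exact le_self_add
  by_cases h2 : R ≤ |2 * π * (y - x) - dispSymbol α (k - l)|
  · have : highModulation α (k - l) R q (y - x) = q (y - x) :=
      Set.indicator_of_mem (s := {ξ : ℝ | R ≤ |2 * π * ξ - dispSymbol α (k - l)|}) h2 q
    rw [this, add_right_comm]
    exact le_add_self
  -- The output modulation equals the two input modulations plus 2π(ξ - y) minus the resonance. Four
  -- terms below R would force the resonance below 4R.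
  have h3 : R ≤ |2 * π * (ξ - y)| := by
    by_contra h3
    push Not at h1 h2 h3
    have h4 : resonance k l α < 4 * R := by
      rw [abs_lt] at h1 h2 h3 hξ
      exact abs_lt.2 ⟨by linarith, by linarith⟩
    linarith
  rw [Set.indicator_of_mem (show ξ - y ∈ {ξ : ℝ | R ≤ |2 * π * ξ|} from h3)]
  exact le_add_self

lemma ltwo_lconv_lconv_le₁ (hp : Measurable p) (hq : Measurable q) (hκ : Measurable κ) :
    ltwo volume (lconv (lconv p q) κ) ≤ ltwo volume p * (∫⁻ x, q x) * ∫⁻ x, κ x :=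
  (ltwo_lconv_le' (measurable_lconv hp hq) hκ).trans (mul_le_mul' (ltwo_lconv_le' hp hq) le_rfl)

lemma ltwo_lconv_lconv_le₂ (hp : Measurable p) (hq : Measurable q) (hκ : Measurable κ) :
    ltwo volume (lconv (lconv p q) κ) ≤ (∫⁻ x, p x) * ltwo volume q * ∫⁻ x, κ x :=
  (ltwo_lconv_le' (measurable_lconv hp hq) hκ).trans (mul_le_mul' (ltwo_lconv_le hp hq) le_rfl)

lemma ltwo_lconv_lconv_le₃ (hp : Measurable p) (hq : Measurable q) (hκ : Measurable κ) :
    ltwo volume (lconv (lconv p q) κ) ≤ (∫⁻ x, p x) * (∫⁻ x, q x) * ltwo volume κ :=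
  (ltwo_lconv_le (measurable_lconv hp hq) hκ).trans_eq (by rw [lintegral_lconv hp hq])

/-- The weighted output of the interaction of two spatial frequencies. -/
def modeOutput (α β b : ℝ) (k : ℤ) (p q κ : ℝ → ℝ≥0∞) (ξ : ℝ) : ℝ≥0∞ :=
  ENNReal.ofReal (outWeight α β b k (2 * π * ξ)) * lconv (lconv p q) κ ξ

/-- At output modulation ≥ R the weight itself decays; below R the decay comes from one of the three
factors. -/
lemma ltwo_modeOutput_le_split (hp : Measurable p) (hq : Measurable q) (hκ : Measurable κ)
    {R : ℝ} (hβ : β ≤ 1) (hb : 1 / 2 < b) (hb' : b < 1) (hk : k ≠ 0) (hR0 : 0 < R)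
    (hR : 4 * R ≤ resonance k l α) :
    ltwo volume (modeOutput α β b k p q κ) ≤
      ENNReal.ofReal (bracket k ^ (1 - β / 2)) *
        (ltwo volume (lconv (lconv (highModulation α l R p) q) κ) +
          ltwo volume (lconv (lconv p (highModulation α (k - l) R q)) κ) +
          ltwo volume (lconv (lconv p q) ({ξ : ℝ | R ≤ |2 * π * ξ|}.indicator κ))) +
      ENNReal.ofReal (bracket k ^ (1 - β * (b - 1 / 2)) * R ^ (b - 1)) *
        ltwo volume (lconv (lconv p q) κ) := by
  have hp' : Measurable (highModulation α l R p) := measurable_highModulation hp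
  have hq' : Measurable (highModulation α (k - l) R q) := measurable_highModulation hq
  have hκ' : Measurable ({ξ : ℝ | R ≤ |2 * π * ξ|}.indicator κ) :=
    hκ.indicator (measurableSet_le measurable_const (by fun_prop))
  have hm1 := measurable_lconv (measurable_lconv hp' hq) hκ
  have hm2 := measurable_lconv (measurable_lconv hp hq') hκ
  have hm3 := measurable_lconv (measurable_lconv hp hq) hκ'
  have hm4 := measurable_lconv (measurable_lconv hp hq) hκ
  refine (ltwo_mono (g := fun ξ => ENNReal.ofReal (bracket k ^ (1 - β / 2)) *
      (lconv (lconv (highModulation α l R p) q) κ ξ +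
      lconv (lconv p (highModulation α (k - l) R q)) κ ξ +
      lconv (lconv p q) ({ξ : ℝ | R ≤ |2 * π * ξ|}.indicator κ) ξ) +
      ENNReal.ofReal (bracket k ^ (1 - β * (b - 1 / 2)) * R ^ (b - 1)) *
        lconv (lconv p q) κ ξ) fun ξ => ?_).trans ?_
  · rcases le_or_gt R |2 * π * ξ - dispSymbol α k| with h | h
    · refine le_trans ?_ le_add_self
      exact mul_le_mul' (ENNReal.ofReal_le_ofReal (outWeight_le_of_le hβ hb hb' hk hR0 h)) le_rfl
    · refine le_trans ?_ le_self_add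
      exact mul_le_mul' (ENNReal.ofReal_le_ofReal (outWeight_le hβ hb hb' hk))
        (lconv_lconv_le_of_lt hp hq hκ hR h)
  · refine (ltwo_add_le (by fun_prop) (by fun_prop)).trans ?_
    rw [ltwo_const_mul _ (by fun_prop), ltwo_const_mul _ (by fun_prop)]
    gcongr
    refine (ltwo_add_le (by fun_prop) (by fun_prop)).trans ?_
    gcongr
    exact ltwo_add_le (by fun_prop) (by fun_prop)

/-- The weighted `L²` norm `‖|2πξ|^{1/2} K‖` of the time cut-off. -/
def halfNorm (K : ℝ → ℝ≥0∞) : ℝ≥0∞ :=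
  ltwo volume (fun ξ => ENNReal.ofReal (|2 * π * ξ| ^ (1 / 2 : ℝ)) * K ξ)

/-- The constant of the estimate without a power of `T`. -/
def resonantConst (α β b : ℝ) (K : ℝ → ℝ≥0∞) : ℝ≥0∞ :=
  ENNReal.ofReal (((1 / 2 : ℝ) ^ (α + 4))⁻¹ * 2 ^ |β|) *
    (3 * (bracketNorm b * ∫⁻ ξ, K ξ) + bracketNorm b * bracketNorm b * halfNorm K)

lemma ltwo_modeOutput_le_gain {K : ℝ → ℝ≥0∞} (hα : 1 < α) (hβ : β ≤ 1) (hb : 1 / 2 < b)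
    (hb' : b < 1) (hk : k ≠ 0) (hl : l ≠ 0) (hkl : k - l ≠ 0) (hT : 0 < T) (hp : Measurable p)
    (hq : Measurable q) (hK : Measurable K) :
    ltwo volume (modeOutput α β b k p q (rescale T K)) ≤
      resonantConst α β b K * ENNReal.ofReal (gain α β (b - 1 / 2) (maxBracket k l)
        (minBracket k l)) * (wNorm α β b l p * wNorm α β b (k - l) q) := by
  set N := maxBracket k l
  set n := minBracket k l
  set c : ℝ := (1 / 2) ^ (α + 4) with hcdef
  have hc : 0 < c := by positivity
  have hc' : c ≤ 1 := Real.rpow_le_one (by norm_num) (by norm_num) (by linarith)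
  have hn : 1 ≤ n := one_le_minBracket k l
  have hN : 1 ≤ N := hn.trans (minBracket_le_maxBracket k l)
  have hΩ := resonance_ge hα.le hk hl hkl
  set R := resonance k l α / 4 with hRdef
  have hR : c * (N ^ α * n) ≤ R := by
    have : c = (1 / 2) ^ (α + 2) / 4 := by
      rw [hcdef, show α + 4 = α + 2 + 2 by ring, Real.rpow_add (by norm_num) _ 2]; norm_num; ring
    rw [this, hRdef]
    linarith
  have hR0 : 0 < R := lt_of_lt_of_le (by positivity) hR
  have hJ : bracket k ≤ N := le_max_left _ _
  have hJ₁ : bracket l ≤ N := (le_max_left _ _).trans (le_max_right _ _)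
  have hJ₂ : bracket (k - l : ℤ) ≤ N := (le_max_right _ _).trans (le_max_right _ _)
  have hδ : 0 < b - 1 / 2 := by linarith
  have hδ' : b - 1 / 2 < 1 / 2 := by linarith
  set A := wNorm α β b l p
  set B := wNorm α β b (k - l) q
  set κ := rescale T K
  have hκ : Measurable κ := measurable_rescale hK
  set m := gain α β (b - 1 / 2) N n with hmdef
  have hm0 : 0 ≤ m := by rw [hmdef]; unfold gain; positivity
  set D : ℝ := c⁻¹ * 2 ^ |β| with hDdef
  have hcD : c⁻¹ * m ≤ D * m := by
    gcongr
    exact le_mul_of_one_le_right (by positivity)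
      (Real.one_le_rpow (by norm_num) (abs_nonneg β))
  have hp' : Measurable (highModulation α l R p) := measurable_highModulation hp
  have hq' : Measurable (highModulation α (k - l) R q) := measurable_highModulation hq
  have hκ' : Measurable ({ξ : ℝ | R ≤ |2 * π * ξ|}.indicator κ) :=
    hκ.indicator (measurableSet_le measurable_const (by fun_prop))
  have hpi : ∫⁻ ξ, p ξ ≤ bracketNorm b * A := lintegral_le_wNorm hb hp
  have hqi : ∫⁻ ξ, q ξ ≤ bracketNorm b * B := lintegral_le_wNorm hb hq
  have hκi : ∫⁻ ξ, κ ξ = ∫⁻ ξ, K ξ := lintegral_rescale hT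
  -- In all cases the product of the output weight and the gain of the distinguished factor is at
  -- most D * m.
  have hin : ∀ j : ℤ, bracket j ≤ N →
      ENNReal.ofReal (bracket k ^ (1 - β / 2)) *
        ENNReal.ofReal (bracket j ^ (β * (b - 1 / 2)) * R ^ (-b)) ≤ ENNReal.ofReal (D * m) := by
    intro j hj
    rw [← ENNReal.ofReal_mul (Real.rpow_nonneg (bracket_pos _).le _)]
    refine ENNReal.ofReal_le_ofReal (le_trans ?_ hcD)
    have := gain_bound_input hα hβ hδ hδ' hc hc' hn hN (one_le_bracket k) hJ
      (one_le_bracket j) hj hR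
    rwa [show 1 / 2 + (b - 1 / 2) = b by ring] at this
  have hcut : ENNReal.ofReal (bracket k ^ (1 - β / 2)) * ENNReal.ofReal (R ^ (-(1 / 2) : ℝ)) ≤
      ENNReal.ofReal (D * m) := by
    rw [← ENNReal.ofReal_mul (Real.rpow_nonneg (bracket_pos _).le _)]
    exact ENNReal.ofReal_le_ofReal
      ((gain_bound_cutoff hα hβ hδ hc hc' hn hN (one_le_bracket k) hJ hR).trans hcD)
  have hout : ∀ j : ℤ, bracket j ≤ N → N ≤ 2 * bracket j →
      ENNReal.ofReal (bracket k ^ (1 - β * (b - 1 / 2)) * R ^ (b - 1)) *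
        ENNReal.ofReal (bracket j ^ (-(β / 2))) ≤ ENNReal.ofReal (D * m) := by
    intro j hj hj'
    rw [← ENNReal.ofReal_mul (mul_nonneg (Real.rpow_nonneg (bracket_pos _).le _)
      (Real.rpow_nonneg hR0.le _))]
    refine ENNReal.ofReal_le_ofReal ?_
    have := gain_bound_output (β := β) hδ hδ' hc hc' hn hN (one_le_bracket k) hJ hj' hj hR
    rwa [show b - 1 / 2 - 1 / 2 = b - 1 by ring] at this
  have h1 : ENNReal.ofReal (bracket k ^ (1 - β / 2)) *
      ltwo volume (lconv (lconv (highModulation α l R p) q) κ) ≤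
      ENNReal.ofReal (D * m) * (bracketNorm b * ∫⁻ ξ, K ξ) * (A * B) := calc
    _ ≤ ENNReal.ofReal (bracket k ^ (1 - β / 2)) *
        (ENNReal.ofReal (bracket l ^ (β * (b - 1 / 2)) * R ^ (-b)) * A * (bracketNorm b * B) *
          ∫⁻ ξ, K ξ) := by
        refine mul_le_mul' le_rfl ((ltwo_lconv_lconv_le₁ hp' hq hκ).trans ?_)
        rw [hκi]
        gcongr
        exact ltwo_highModulation_le hb hR0 hp
    _ = (ENNReal.ofReal (bracket k ^ (1 - β / 2)) *
        ENNReal.ofReal (bracket l ^ (β * (b - 1 / 2)) * R ^ (-b))) *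
          (bracketNorm b * ∫⁻ ξ, K ξ) * (A * B) := by ring
    _ ≤ _ := by
        gcongr ?_ * _ * _
        exact hin l hJ₁
  have h2 : ENNReal.ofReal (bracket k ^ (1 - β / 2)) *
      ltwo volume (lconv (lconv p (highModulation α (k - l) R q)) κ) ≤
      ENNReal.ofReal (D * m) * (bracketNorm b * ∫⁻ ξ, K ξ) * (A * B) := calc
    _ ≤ ENNReal.ofReal (bracket k ^ (1 - β / 2)) *
        ((bracketNorm b * A) *
          (ENNReal.ofReal (bracket (k - l : ℤ) ^ (β * (b - 1 / 2)) * R ^ (-b)) * B) *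
          ∫⁻ ξ, K ξ) := by
        refine mul_le_mul' le_rfl ((ltwo_lconv_lconv_le₂ hp hq' hκ).trans ?_)
        rw [hκi]
        gcongr
        exact ltwo_highModulation_le hb hR0 hq
    _ = (ENNReal.ofReal (bracket k ^ (1 - β / 2)) *
        ENNReal.ofReal (bracket (k - l : ℤ) ^ (β * (b - 1 / 2)) * R ^ (-b))) *
          (bracketNorm b * ∫⁻ ξ, K ξ) * (A * B) := by ring
    _ ≤ _ := by
        gcongr ?_ * _ * _
        exact hin (k - l) hJ₂
  have h3 : ENNReal.ofReal (bracket k ^ (1 - β / 2)) *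
      ltwo volume (lconv (lconv p q) ({ξ : ℝ | R ≤ |2 * π * ξ|}.indicator κ)) ≤
      ENNReal.ofReal (D * m) * (bracketNorm b * bracketNorm b * halfNorm K) * (A * B) := calc
    _ ≤ ENNReal.ofReal (bracket k ^ (1 - β / 2)) *
        ((bracketNorm b * A) * (bracketNorm b * B) *
          (ENNReal.ofReal (R ^ (-(1 / 2) : ℝ)) * halfNorm K)) := by
        refine mul_le_mul' le_rfl ((ltwo_lconv_lconv_le₃ hp hq hκ').trans ?_)
        gcongr
        exact ltwo_indicator_rescale_le hT hR0
    _ = (ENNReal.ofReal (bracket k ^ (1 - β / 2)) * ENNReal.ofReal (R ^ (-(1 / 2) : ℝ))) *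
          (bracketNorm b * bracketNorm b * halfNorm K) * (A * B) := by ring
    _ ≤ _ := by gcongr
  have h4 : ENNReal.ofReal (bracket k ^ (1 - β * (b - 1 / 2)) * R ^ (b - 1)) *
      ltwo volume (lconv (lconv p q) κ) ≤
      ENNReal.ofReal (D * m) * (bracketNorm b * ∫⁻ ξ, K ξ) * (A * B) := by
    have hsum : bracket k ≤ bracket l + bracket (k - l : ℤ) := by
      have := bracket_add_le (l : ℝ) ((k - l : ℤ) : ℝ)
      rwa [show (l : ℝ) + ((k - l : ℤ) : ℝ) = k by push_cast; ring] at this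
    -- The larger input goes in L² and the other in L¹; by ⟨k⟩ ≤ ⟨l⟩ + ⟨k-l⟩ the larger input has
    -- bracket at least N/2.
    rcases le_total (bracket (k - l : ℤ)) (bracket l) with h | h
    · have hN2 : N ≤ 2 * bracket l := by
        have := bracket_pos l
        exact max_le (by linarith) (max_le (by linarith) (by linarith))
      calc _ ≤ ENNReal.ofReal (bracket k ^ (1 - β * (b - 1 / 2)) * R ^ (b - 1)) *
            ((ENNReal.ofReal (bracket l ^ (-(β / 2))) * A) * (bracketNorm b * B) *
              ∫⁻ ξ, K ξ) := by
            refine mul_le_mul' le_rfl ((ltwo_lconv_lconv_le₁ hp hq hκ).trans ?_)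
            rw [hκi]
            gcongr
            exact ltwo_le_wNorm hb hp
        _ = (ENNReal.ofReal (bracket k ^ (1 - β * (b - 1 / 2)) * R ^ (b - 1)) *
            ENNReal.ofReal (bracket l ^ (-(β / 2)))) * (bracketNorm b * ∫⁻ ξ, K ξ) *
              (A * B) := by ring
        _ ≤ _ := by
            gcongr ?_ * _ * _
            exact hout l hJ₁ hN2
    · have hN2 : N ≤ 2 * bracket (k - l : ℤ) := by
        have := bracket_pos (k - l : ℤ)
        exact max_le (by linarith) (max_le (by linarith) (by linarith))
      calc _ ≤ ENNReal.ofReal (bracket k ^ (1 - β * (b - 1 / 2)) * R ^ (b - 1)) *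
            ((bracketNorm b * A) * (ENNReal.ofReal (bracket (k - l : ℤ) ^ (-(β / 2))) * B) *
              ∫⁻ ξ, K ξ) := by
            refine mul_le_mul' le_rfl ((ltwo_lconv_lconv_le₂ hp hq hκ).trans ?_)
            rw [hκi]
            gcongr
            exact ltwo_le_wNorm hb hq
        _ = (ENNReal.ofReal (bracket k ^ (1 - β * (b - 1 / 2)) * R ^ (b - 1)) *
            ENNReal.ofReal (bracket (k - l : ℤ) ^ (-(β / 2)))) * (bracketNorm b * ∫⁻ ξ, K ξ) *
              (A * B) := by ring
        _ ≤ _ := by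
            gcongr ?_ * _ * _
            exact hout (k - l) hJ₂ hN2
  refine (ltwo_modeOutput_le_split (l := l) hp hq hκ hβ hb hb' hk hR0
    (by rw [hRdef]; linarith)).trans ?_
  rw [mul_add, mul_add]
  refine (add_le_add (add_le_add (add_le_add h1 h2) h3) h4).trans (le_of_eq ?_)
  rw [resonantConst, ENNReal.ofReal_mul (by positivity : (0:ℝ) ≤ D)]
  ring

/-- Both inputs go in L¹ and the cut-off in L², where its dilation yields T^{1/2}; no modulation is
exploited. -/
lemma ltwo_modeOutput_le_time {K : ℝ → ℝ≥0∞} (hβ : β ≤ 1) (hb : 1 / 2 < b)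
    (hb' : b < 1) (hk : k ≠ 0) (hT : 0 < T) (hp : Measurable p)
    (hq : Measurable q) (hK : Measurable K) :
    ltwo volume (modeOutput α β b k p q (rescale T K)) ≤
      bracketNorm b * bracketNorm b * ltwo volume K *
        ENNReal.ofReal (maxBracket k l ^ (1 - β / 2) * T ^ (1 / 2 : ℝ)) *
        (wNorm α β b l p * wNorm α β b (k - l) q) := by
  have hκ : Measurable (rescale T K) := measurable_rescale hK
  have hN : 0 < maxBracket k l := (bracket_pos k).trans_le (le_max_left _ _)
  calc ltwo volume (modeOutput α β b k p q (rescale T K))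
      ≤ ltwo volume (fun ξ => ENNReal.ofReal (maxBracket k l ^ (1 - β / 2)) *
          lconv (lconv p q) (rescale T K) ξ) := by
        refine ltwo_mono fun ξ => mul_le_mul' (ENNReal.ofReal_le_ofReal ?_) le_rfl
        exact (outWeight_le hβ hb hb' hk).trans (Real.rpow_le_rpow (bracket_pos _).le
          (le_max_left _ _) (by linarith))
    _ ≤ ENNReal.ofReal (maxBracket k l ^ (1 - β / 2)) *
          ((bracketNorm b * wNorm α β b l p) * (bracketNorm b * wNorm α β b (k - l) q) *
          (ENNReal.ofReal (T ^ (1 / 2 : ℝ)) * ltwo volume K)) := by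
        rw [ltwo_const_mul _ (by fun_prop), ← ltwo_rescale hT]
        gcongr
        refine (ltwo_lconv_lconv_le₃ hp hq hκ).trans ?_
        gcongr
        · exact lintegral_le_wNorm hb hp
        · exact lintegral_le_wNorm hb hq
    _ = _ := by
        rw [ENNReal.ofReal_mul (by positivity)]
        ring

/-- The constant of the single-mode estimate. -/
def modeConst (α β b : ℝ) (K : ℝ → ℝ≥0∞) : ℝ≥0∞ :=
  resonantConst α β b K + bracketNorm b * bracketNorm b * ltwo volume K

/-- The interaction of two spatial frequencies is bounded with a power of `T` and a summable
factor. -/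
lemma ltwo_modeOutput_le {K : ℝ → ℝ≥0∞} (hα : 1 < α) (hαβ : 2 - α < β) (hβ : β ≤ 1)
    (hb : b = 1 / 2 + smallParam α β)
    (hk : k ≠ 0) (hl : l ≠ 0) (hkl : k - l ≠ 0) (hT : 0 < T) (hp : Measurable p)
    (hq : Measurable q) (hK : Measurable K) :
    ltwo volume (modeOutput α β b k p q (rescale T K)) ≤
      modeConst α β b K * ENNReal.ofReal (T ^ (smallParam α β / 2)) *
        ENNReal.ofReal (minBracket k l ^ (-(1 / 2 + ((α + β) / 2 - 1) / 2))) *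
        (wNorm α β b l p * wNorm α β b (k - l) q) := by
  have h0 := smallParam_pos hα hαβ
  have h1 := smallParam_lt hα hβ
  have h2 := ltwo_modeOutput_le_gain hα hβ (by linarith) (by linarith) hk hl hkl hT hp hq hK
    (b := b)
  have h3 := ltwo_modeOutput_le_time (α := α) (l := l) hβ (by linarith) (by linarith) hk hT hp hq
    hK (b := b)
  have h4 := min_gain_le hα hαβ hβ (one_le_minBracket k l) (minBracket_le_maxBracket k l) hT
  rw [show b - 1 / 2 = smallParam α β by linarith] at h2
  set x := gain α β (smallParam α β) (maxBracket k l) (minBracket k l)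
  set y := maxBracket k l ^ (1 - β / 2) * T ^ (1 / 2 : ℝ)
  calc ltwo volume (modeOutput α β b k p q (rescale T K))
      ≤ modeConst α β b K * ENNReal.ofReal (min x y) *
          (wNorm α β b l p * wNorm α β b (k - l) q) := by
        rcases min_choice x y with h | h <;> rw [h]
        · refine h2.trans ?_
          gcongr
          exact le_self_add
        · refine h3.trans ?_
          gcongr
          exact le_add_self
    _ ≤ _ := by
        rw [mul_assoc (modeConst α β b K) (ENNReal.ofReal (T ^ _)), ← ENNReal.ofReal_mul (by positivity)]
        gcongr

end SingleMode

/-! ### Summation over the spatial frequencies -/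

/-- The `ℓ²(ℤ)` norm. -/
abbrev ellTwo (a : ℤ → ℝ≥0∞) : ℝ≥0∞ := ltwo Measure.count a

lemma ellTwo_sq (a : ℤ → ℝ≥0∞) : ellTwo a ^ 2 = ∑' k, a k ^ 2 := by
  rw [ltwo_sq, lintegral_count]

lemma tsum_mul_le_ellTwo (a b : ℤ → ℝ≥0∞) : ∑' k, a k * b k ≤ ellTwo a * ellTwo b := by
  rw [← lintegral_count]
  exact lintegral_mul_le_ltwo (by fun_prop) (by fun_prop)

lemma ellTwo_comp_sub (a : ℤ → ℝ≥0∞) (k : ℤ) : ellTwo (fun l => a (k - l)) = ellTwo a := by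
  unfold ellTwo ltwo
  rw [lintegral_count, lintegral_count]
  congr 1
  exact (Equiv.subLeft k).tsum_eq (fun l => a l ^ 2)

/-- Cauchy-Schwarz in l against w, then interchange of the sums of a_l² b_{k-l}². -/
lemma ellTwo_conv_weight_le (w a b : ℤ → ℝ≥0∞) :
    ellTwo (fun k => ∑' l, w l * (a l * b (k - l))) ≤ ellTwo w * (ellTwo a * ellTwo b) := by
  rw [ltwo_le_iff, lintegral_count]
  calc ∑' k, (∑' l, w l * (a l * b (k - l))) ^ 2
      ≤ ∑' k, ellTwo w ^ 2 * ∑' l, (a l * b (k - l)) ^ 2 := by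
        refine ENNReal.tsum_le_tsum fun k => ?_
        rw [← ellTwo_sq (fun l => a l * b (k - l)), ← mul_pow]
        exact pow_le_pow_left' (tsum_mul_le_ellTwo w _) 2
    _ = ellTwo w ^ 2 * ∑' l, a l ^ 2 * ∑' k, b (k - l) ^ 2 := by
        rw [ENNReal.tsum_mul_left, ENNReal.tsum_comm]
        simp_rw [mul_pow, ENNReal.tsum_mul_left]
    _ = _ := by
        have : ∀ l, ∑' k, b (k - l) ^ 2 = ellTwo b ^ 2 := fun l => by
          rw [ellTwo_sq]
          exact (Equiv.subRight l).tsum_eq (fun k => b k ^ 2)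
        simp_rw [this]
        rw [ENNReal.tsum_mul_right, ← ellTwo_sq]
        ring

lemma ellTwo_conv_weight_le' (w a b : ℤ → ℝ≥0∞) :
    ellTwo (fun k => ∑' l, w (k - l) * (a l * b (k - l))) ≤
      ellTwo w * (ellTwo a * ellTwo b) := by
  rw [mul_comm (ellTwo a)]
  refine le_trans (ltwo_mono fun k => le_of_eq ?_) (ellTwo_conv_weight_le w b a)
  rw [← (Equiv.subLeft k).tsum_eq (fun l => w l * (b l * a (k - l)))]
  simp [mul_comm]

/-- The summable weight. -/
def freqWeight (s : ℝ) (k : ℤ) : ℝ≥0∞ := ENNReal.ofReal (bracket k ^ (-s))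

lemma ellTwo_freqWeight_lt_top {s : ℝ} (hs : 1 / 2 < s) : ellTwo (freqWeight s) < ⊤ := by
  refine ENNReal.rpow_lt_top_of_nonneg (by norm_num) ?_
  rw [lintegral_count]
  have h1 : Summable fun k : ℤ => bracket k ^ (-(2 * s)) := by
    refine Summable.of_norm_bounded_eventually
      (Real.summable_abs_int_rpow (b := 2 * s) (by linarith)) ?_
    filter_upwards [(Set.finite_singleton (0 : ℤ)).eventually_cofinite_notMem] with k hk
    rw [Set.mem_singleton_iff] at hk
    rw [Real.norm_of_nonneg (Real.rpow_nonneg (bracket_pos _).le _)]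
    exact Real.rpow_le_rpow_of_nonpos (by have := one_le_abs_intCast hk; linarith)
      (abs_le_bracket _) (by linarith)
  have h2 : ∀ k : ℤ, freqWeight s k ^ 2 = ENNReal.ofReal (bracket k ^ (-(2 * s))) := fun k => by
    rw [freqWeight, ← ENNReal.ofReal_pow (Real.rpow_nonneg (bracket_pos _).le _),
      ← Real.rpow_mul_natCast (bracket_pos _).le]
    congr 2; push_cast; ring
  simp_rw [h2]
  exact h1.tsum_ofReal_ne_top

lemma ofReal_minBracket_le {s : ℝ} (k l : ℤ) :
    ENNReal.ofReal (minBracket k l ^ (-s)) ≤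
      freqWeight s k + freqWeight s l + freqWeight s (k - l) := by
  unfold minBracket
  rcases min_choice (bracket k) (min (bracket l) (bracket (k - l : ℤ))) with h | h
  · rw [h, add_assoc]
    exact le_self_add
  · rw [h]
    rcases min_choice (bracket l) (bracket (k - l : ℤ)) with h' | h'
    · rw [h', add_right_comm]
      exact le_add_self
    · rw [h']
      exact le_add_self

lemma ellTwo_interaction_le (s : ℝ) (a b : ℤ → ℝ≥0∞) :
    ellTwo (fun k => ∑' l, ENNReal.ofReal (minBracket k l ^ (-s)) * (a l * b (k - l))) ≤
      3 * ellTwo (freqWeight s) * (ellTwo a * ellTwo b) := by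
  set w := freqWeight s
  calc _ ≤ ellTwo (fun k => (ellTwo a * ellTwo b) * w k +
        ∑' l, w l * (a l * b (k - l)) + ∑' l, w (k - l) * (a l * b (k - l))) := by
        refine ltwo_mono fun k => ?_
        -- When the output frequency is smallest, the convolution is bounded uniformly in k and the
        -- ℓ² norm falls on w.
        have h1 : w k * ∑' l, a l * b (k - l) ≤ (ellTwo a * ellTwo b) * w k := by
          rw [mul_comm]
          gcongr
          refine (tsum_mul_le_ellTwo a (fun l => b (k - l))).trans_eq ?_
          rw [ellTwo_comp_sub]
        refine le_trans ?_ (add_le_add (add_le_add h1 le_rfl) le_rfl)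
        rw [← ENNReal.tsum_mul_left, ← ENNReal.tsum_add, ← ENNReal.tsum_add]
        refine ENNReal.tsum_le_tsum fun l => ?_
        rw [← add_mul, ← add_mul]
        gcongr
        exact ofReal_minBracket_le k l
    _ ≤ (ellTwo a * ellTwo b) * ellTwo w + ellTwo w * (ellTwo a * ellTwo b) +
          ellTwo w * (ellTwo a * ellTwo b) := by
        refine (ltwo_add_le (by fun_prop) (by fun_prop)).trans ?_
        gcongr
        · refine (ltwo_add_le (by fun_prop) (by fun_prop)).trans ?_
          gcongr
          · rw [ltwo_const_mul _ (by fun_prop)]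
          · exact ellTwo_conv_weight_le w a b
        · exact ellTwo_conv_weight_le' w a b
    _ = _ := by ring

/-! ### The estimate summed over all pairs of frequencies -/

section

variable {α β b T : ℝ} {P Q : ℤ → ℝ → ℝ≥0∞} {K : ℝ → ℝ≥0∞}

/-- The constant of the bilinear estimate. -/
def bilinearConst (α β b : ℝ) (K : ℝ → ℝ≥0∞) : ℝ≥0∞ :=
  modeConst α β b K * (3 * ellTwo (freqWeight (1 / 2 + ((α + β) / 2 - 1) / 2)))

lemma wNorm_zero (k : ℤ) : wNorm α β b k 0 = 0 := by
  simp [wNorm, ltwo]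

lemma lconv_zero_left (f : ℝ → ℝ≥0∞) : lconv 0 f = 0 := by
  funext x; simp [lconv]

lemma lconv_zero_right (f : ℝ → ℝ≥0∞) : lconv f 0 = 0 := by
  funext x; simp [lconv]

lemma measurable_modeOutput {p q κ : ℝ → ℝ≥0∞} {k : ℤ} (hp : Measurable p) (hq : Measurable q)
    (hκ : Measurable κ) : Measurable (modeOutput α β b k p q κ) := by
  have h : Continuous fun ξ => outWeight α β b k (2 * π * ξ) := by
    unfold outWeight
    exact (continuous_zWeight.comp (by fun_prop)).mul continuous_const
  have := h.measurable
  have := measurable_lconv (measurable_lconv hp hq) hκ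
  unfold modeOutput
  fun_prop

/-- The bilinear estimate for the absolute values of the Fourier transforms. -/
theorem ellTwo_output_le (hα : 1 < α) (hαβ : 2 - α < β) (hβ : β ≤ 1)
    (hb : b = 1 / 2 + smallParam α β) (hT : 0 < T) (hP : ∀ k, Measurable (P k))
    (hQ : ∀ k, Measurable (Q k)) (hP0 : P 0 = 0) (hQ0 : Q 0 = 0) (hK : Measurable K) :
    ellTwo (fun k => if k = 0 then 0 else
      ltwo volume (fun ξ => ∑' l, modeOutput α β b k (P l) (Q (k - l)) (rescale T K) ξ)) ≤
      bilinearConst α β b K * ENNReal.ofReal (T ^ (smallParam α β / 2)) *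
        (ellTwo (fun k => wNorm α β b k (P k)) * ellTwo (fun k => wNorm α β b k (Q k))) := by
  set s := 1 / 2 + ((α + β) / 2 - 1) / 2 with hs
  set D := modeConst α β b K * ENNReal.ofReal (T ^ (smallParam α β / 2)) with hD
  calc _ ≤ ellTwo (fun k => D * ∑' l, ENNReal.ofReal (minBracket k l ^ (-s)) *
        (wNorm α β b l (P l) * wNorm α β b (k - l) (Q (k - l)))) := by
        refine ltwo_mono fun k => ?_
        split_ifs with hk
        · exact zero_le
        refine (ltwo_tsum_le fun l => (measurable_modeOutput (hP l) (hQ _)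
          (measurable_rescale hK)).aemeasurable).trans ?_
        rw [← ENNReal.tsum_mul_left]
        refine ENNReal.tsum_le_tsum fun l => ?_
        rw [← mul_assoc]
        rcases eq_or_ne l 0 with rfl | hl
        · rw [hP0]
          simp [modeOutput, lconv_zero_left, ltwo]
        rcases eq_or_ne (k - l) 0 with hkl | hkl
        · rw [hkl, hQ0]
          simp [modeOutput, lconv_zero_left, lconv_zero_right, ltwo]
        exact ltwo_modeOutput_le hα hαβ hβ hb hk hl hkl hT (hP l) (hQ _) hK
    _ ≤ D * (3 * ellTwo (freqWeight s) * (ellTwo (fun k => wNorm α β b k (P k)) *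
          ellTwo (fun k => wNorm α β b k (Q k)))) := by
        refine (ltwo_const_mul (μ := Measure.count) D (by fun_prop)).le.trans ?_
        gcongr
        exact ellTwo_interaction_le s (fun k => wNorm α β b k (P k))
          (fun k => wNorm α β b k (Q k))
    _ = _ := by
        rw [bilinearConst, hD]
        ring

lemma bilinearConst_lt_top (hα : 1 < α) (hαβ : 2 - α < β)
    (hb : b = 1 / 2 + smallParam α β) (hK1 : ∫⁻ ξ, K ξ < ⊤) (hK2 : ltwo volume K < ⊤)
    (hK3 : halfNorm K < ⊤) : bilinearConst α β b K < ⊤ := by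
  have h0 := smallParam_pos hα hαβ
  have h1 : bracketNorm b < ⊤ := bracketNorm_lt_top (by linarith)
  have h2 := ellTwo_freqWeight_lt_top (s := 1 / 2 + ((α + β) / 2 - 1) / 2) (by linarith)
  unfold bilinearConst modeConst resonantConst
  finiteness

end

/-! ### Fourier coefficients of products on the torus -/

open AddCircle in
lemma spatialCoeff_eq (f : Torus → ℂ) (k : ℤ) :
    spatialCoeff f k = 2 * π * fourierCoeff f k := by
  rw [spatialCoeff, fourierCoeff, AddCircle.volume_eq_smul_haarAddCircle, integral_smul_measure,
    ENNReal.toReal_ofReal Real.two_pi_pos.le]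
  simp [smul_eq_mul]

open AddCircle ComplexConjugate in
-- Parseval for the pair conj(f) e_k and g, reindexed by l ↦ k - l.
lemma hasSum_fourierCoeff_mul {f g : Torus → ℂ} (hf : MemLp f 2 haarAddCircle)
    (hg : MemLp g 2 haarAddCircle) (k : ℤ) :
    HasSum (fun l => fourierCoeff f l * fourierCoeff g (k - l))
      (fourierCoeff (fun x => f x * g x) k) := by
  have hx : MemLp (fun t : Torus => conj (f t) * fourier k t) 2 haarAddCircle := by
    refine hf.of_le ?_ (Filter.Eventually.of_forall fun t => ?_)
    · exact (Complex.continuous_conj.comp_aestronglyMeasurable hf.1).mul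
        (map_continuous (fourier k)).aestronglyMeasurable
    · rw [norm_mul, RCLike.norm_conj, fourier_apply, Circle.norm_coe, mul_one]
  have h := (fourierBasis (T := 2 * π)).hasSum_inner_mul_inner (hx.toLp _) (hg.toLp g)
  have h1 : ∀ i : ℤ, inner ℂ (hx.toLp _) (fourierBasis (T := 2 * π) i) =
      fourierCoeff f (k - i) := fun i => by
    rw [← inner_conj_symm, ← HilbertBasis.repr_apply_apply, fourierBasis_repr,
      fourierCoeff_congr_ae hx.coeFn_toLp, fourierCoeff, fourierCoeff, ← integral_conj]
    refine integral_congr_ae (Filter.Eventually.of_forall fun t => ?_)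
    simp only [smul_eq_mul, map_mul, Complex.conj_conj]
    rw [← fourier_neg, ← fourier_neg, neg_neg, show -(k - i) = i + -k by ring, fourier_add]
    ring
  have h2 : ∀ i : ℤ, inner ℂ (fourierBasis (T := 2 * π) i) (hg.toLp g) = fourierCoeff g i :=
    fun i => by
    rw [← HilbertBasis.repr_apply_apply, fourierBasis_repr, fourierCoeff_congr_ae hg.coeFn_toLp]
  have h3 : inner ℂ (hx.toLp _) (hg.toLp g) = fourierCoeff (fun x => f x * g x) k := by
    rw [L2.inner_def, fourierCoeff]
    refine integral_congr_ae ?_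
    filter_upwards [hx.coeFn_toLp, hg.coeFn_toLp] with t ht ht'
    rw [ht, ht']
    simp only [RCLike.inner_apply, smul_eq_mul, map_mul, Complex.conj_conj]
    rw [← fourier_neg]
    ring
  rw [h3] at h
  simp_rw [h1, h2] at h
  convert! (Equiv.subLeft k).hasSum_iff.2 h using 2 with l
  simp

lemma hasSum_spatialCoeff_mul (f g : L2Torus) (k : ℤ) :
    HasSum (fun l => spatialCoeff f l * spatialCoeff g (k - l))
      (2 * π * spatialCoeff (fun x => f x * g x) k) := by
  have hf := MeasureTheory.memLp_haarAddCircle_iff.2 (Lp.memLp f)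
  have hg := MeasureTheory.memLp_haarAddCircle_iff.2 (Lp.memLp g)
  have h := (hasSum_fourierCoeff_mul hf hg k).mul_left ((2 * π : ℂ) * (2 * π))
  convert! h using 1
  · funext l
    rw [spatialCoeff_eq, spatialCoeff_eq]; ring
  · rw [spatialCoeff_eq]; ring

/-! ### Inverse Fourier transforms of integrable functions -/

lemma continuous_fourierInv {P : ℝ → ℂ} (hP : Integrable P) : Continuous (𝓕⁻ P) :=
  VectorFourier.fourierIntegral_continuous Real.continuous_fourierChar
    (L := -innerₗ ℝ) (by simp; fun_prop) hP

/-- The inverse transform is self-adjoint for the bilinear pairing, because its phase is symmetric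
in ξ and t. -/
lemma integral_fourierInv_mul {P : ℝ → ℂ} (hP : Integrable P) (φ : 𝓢(ℝ, ℂ)) :
    ∫ ξ, 𝓕⁻ φ ξ * P ξ = ∫ t, φ t * 𝓕⁻ P t := by
  have h := VectorFourier.integral_fourierIntegral_smul_eq_flip (L := -innerₗ ℝ)
    Real.continuous_fourierChar (by simp; fun_prop) (φ.integrable (μ := volume)) hP
  rw [SchwartzMap.fourierInv_coe]
  have e : (-innerₗ ℝ : ℝ →ₗ[ℝ] ℝ →ₗ[ℝ] ℝ).flip = -innerₗ ℝ := by
    ext; simp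
  rw [e] at h
  exact h

lemma fourierInv_mul_convolution {P Q : ℝ → ℂ} (hP : Integrable P) (hQ : Integrable Q) (t : ℝ) :
    𝓕⁻ (convolution P Q (ContinuousLinearMap.mul ℂ ℂ) volume) t = 𝓕⁻ P t * 𝓕⁻ Q t := by
  simp_rw [Real.fourierInv_eq_fourier_neg]
  exact Real.fourier_mul_convolution_eq hP hQ (-t)

lemma enorm_convolution_le (P Q : ℝ → ℂ) (ξ : ℝ) :
    ‖convolution P Q (ContinuousLinearMap.mul ℂ ℂ) volume ξ‖ₑ ≤
      lconv (fun x => ‖P x‖ₑ) (fun x => ‖Q x‖ₑ) ξ := by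
  refine (enorm_integral_le_lintegral_enorm _).trans (le_of_eq ?_)
  refine lintegral_congr fun y => ?_
  simp

lemma AEStronglyMeasurable.comp_const_mul {F : ℝ → ℂ} (hF : AEStronglyMeasurable F volume) {a : ℝ}
    (ha : a ≠ 0) : AEStronglyMeasurable (fun ξ => F (a * ξ)) volume := by
  refine hF.comp_quasiMeasurePreserving ⟨by fun_prop, ?_⟩
  rw [Real.map_volume_mul_left ha]
  exact Measure.smul_absolutelyContinuous

lemma apply_eq_integral_fourierInv {f : 𝓢'(ℝ, ℂ)} {F P : ℝ → ℂ} (hF : HasTimeFourier f F)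
    (hP : Integrable P) (hFP : (fun ξ => F (2 * π * ξ)) =ᵐ[volume] P) (φ : 𝓢(ℝ, ℂ)) :
    f φ = ∫ t, φ t * 𝓕⁻ P t := by
  have h := (hF.2 (𝓕⁻ φ)).2
  rw [TemperedDistribution.fourier_apply, FourierTransform.fourier_fourierInv_eq] at h
  rw [h, ← integral_fourierInv_mul hP]
  refine integral_congr_ae (hFP.mono fun ξ hξ => ?_)
  dsimp only at hξ ⊢
  rw [hξ]

/-- Two functions that agree as distributions on `(0, T)` agree almost everywhere there. -/
lemma ae_eq_of_forall_schwartz {T : ℝ} {g U : ℝ → ℂ} (hg : IntegrableOn g (Set.Ioo 0 T))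
    (hU : Continuous U)
    (h : ∀ φ : 𝓢(ℝ, ℂ), tsupport φ ⊆ Set.Ioo 0 T →
      ∫ t, φ t * U t = ∫ t in Set.Ioo 0 T, φ t * g t) :
    ∀ᵐ t ∂volume.restrict (Set.Ioo 0 T), g t = U t := by
  rw [ae_restrict_iff' measurableSet_Ioo]
  have hUi : IntegrableOn U (Set.Ioo 0 T) :=
    (hU.continuousOn.integrableOn_Icc (a := 0) (b := T)).mono_set Set.Ioo_subset_Icc_self
  have key := isOpen_Ioo.ae_eq_zero_of_integral_contDiff_smul_eq_zero (E := ℝ) (μ := volume)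
    (f := (Set.Ioo 0 T).indicator (fun t => g t - U t)) (U := Set.Ioo 0 T) ?_ ?_
  · filter_upwards [key] with t ht htm
    have := ht htm
    rw [Set.indicator_of_mem htm] at this
    exact sub_eq_zero.1 this
  · exact ((hg.sub hUi).integrable_indicator measurableSet_Ioo).locallyIntegrable
      |>.locallyIntegrableOn _
  -- The fundamental lemma tests only with real smooth bumps, which are promoted here to complex
  -- Schwartz functions.
  · intro χ hχ hχc hχs
    have hc : HasCompactSupport (fun t => (χ t : ℂ)) :=
      hχc.comp_left (g := fun x : ℝ => (x : ℂ)) Complex.ofReal_zero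
    have hd : ContDiff ℝ (⊤ : ℕ∞) (fun t => (χ t : ℂ)) := Complex.ofRealCLM.contDiff.comp hχ
    set φ : 𝓢(ℝ, ℂ) := hc.toSchwartzMap hd with hφ
    have hφv : ∀ t, φ t = (χ t : ℂ) := fun t => rfl
    have hs : tsupport φ ⊆ Set.Ioo 0 T :=
      (closure_mono (Function.support_comp_subset (g := fun x : ℝ => (x : ℂ))
        Complex.ofReal_zero χ)).trans hχs
    have h1 := h φ hs
    have h0 : ∀ t, t ∉ Set.Ioo 0 T → φ t = 0 := fun t ht =>
      image_eq_zero_of_notMem_tsupport fun h => ht (hs h)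
    rw [← setIntegral_eq_integral_of_forall_compl_eq_zero (s := Set.Ioo 0 T)
      (fun t ht => by rw [h0 t ht, zero_mul])] at h1
    have hb : ∃ C, ∀ t, ‖φ t‖ ≤ C := ⟨_, fun t => SchwartzMap.norm_le_seminorm ℝ φ t⟩
    obtain ⟨C, hC⟩ := hb
    have e : (fun t => χ t • (Set.Ioo 0 T).indicator (fun t => g t - U t) t) =
        (Set.Ioo 0 T).indicator (fun t => φ t * g t - φ t * U t) := by
      funext t
      by_cases ht : t ∈ Set.Ioo 0 T
      · rw [Set.indicator_of_mem ht, Set.indicator_of_mem ht, hφv, ← mul_sub, Complex.real_smul]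
      · rw [Set.indicator_of_notMem ht, Set.indicator_of_notMem ht, smul_zero]
    rw [e, integral_indicator measurableSet_Ioo, integral_sub, h1, sub_self]
    · exact hg.bdd_mul φ.continuous.aestronglyMeasurable (Filter.Eventually.of_forall hC)
    · exact hUi.bdd_mul φ.continuous.aestronglyMeasurable (Filter.Eventually.of_forall hC)

/-! ### Extensions and their Fourier transforms -/

lemma wNorm_le_ellTwo {α β b : ℝ} (p : ℤ → ℝ → ℝ≥0∞) (k : ℤ) :
    wNorm α β b k (p k) ≤ ellTwo (fun k => wNorm α β b k (p k)) := by
  rw [← ENNReal.pow_le_pow_left_iff two_ne_zero, ellTwo_sq]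
  exact ENNReal.le_tsum (f := fun k => wNorm α β b k (p k) ^ 2) k

lemma ellTwo_wNorm_sq {α β b : ℝ} (p : ℤ → ℝ → ℝ≥0∞) (hp : p 0 = 0) :
    ellTwo (fun k => wNorm α β b k (p k)) ^ 2 = ∑' k : {k : ℤ // k ≠ 0},
      ∫⁻ ξ, (ENNReal.ofReal (zWeight α β b k (2 * π * ξ)) * p k ξ) ^ 2 := by
  rw [ellTwo_sq]
  have h := tsum_subtype_eq_of_support_subset (f := fun k => wNorm α β b k (p k) ^ 2)
    (s := {k : ℤ | k ≠ 0}) (fun k hk => ?_)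
  · rw [← h]
    refine tsum_congr fun k => ?_
    rw [wNorm, ltwo_sq]
  · rintro rfl
    apply hk
    simp [hp, wNorm_zero]

/-- A function of finite restricted norm has, on `(0, T)`, an extension whose time Fourier transform
is integrable at each spatial frequency. -/
lemma exists_profile {α β b T : ℝ} (hb : 1 / 2 < b) {f : ℝ → ℤ → ℂ} {a : ℝ≥0∞}
    (hf : zNormT α β b T f < a) :
    ∃ P : ℤ → ℝ → ℂ, (∀ k, Measurable (P k)) ∧ P 0 = 0 ∧ (∀ k, Integrable (P k)) ∧
      ellTwo (fun k => wNorm α β b k (fun ξ => ‖P k ξ‖ₑ)) ≤ a ∧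
      ∀ᵐ t ∂volume.restrict (Set.Ioo 0 T), ∀ k, f t k = 𝓕⁻ (P k) t := by
  unfold zNormT zNorm at hf
  simp only [iInf_lt_iff] at hf
  obtain ⟨w, hw, F, ⟨hw0, hF⟩, hlt⟩ := hf
  have h2π : (2 * π : ℝ) ≠ 0 := Real.two_pi_pos.ne'
  have hm : ∀ k, AEStronglyMeasurable (fun ξ => F k (2 * π * ξ)) volume := fun k =>
    AEStronglyMeasurable.comp_const_mul (hF k).1 h2π
  -- A Borel representative in the variable ξ = τ/2π; the zero mode may be reset because the
  -- extension vanishes there.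
  set P : ℤ → ℝ → ℂ := fun k => if k = 0 then 0 else (hm k).mk _ with hPdef
  have hP0 : P 0 = 0 := if_pos rfl
  have hPk : ∀ k, k ≠ 0 → P k = (hm k).mk _ := fun k hk => if_neg hk
  have hPm : ∀ k, Measurable (P k) := fun k => by
    rcases eq_or_ne k 0 with rfl | hk
    · rw [hP0]; exact measurable_const
    · rw [hPk k hk]; exact (hm k).stronglyMeasurable_mk.measurable
  have hPF : ∀ k, k ≠ 0 → (fun ξ => F k (2 * π * ξ)) =ᵐ[volume] P k := fun k hk => by
    rw [hPk k hk]; exact (hm k).ae_eq_mk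
  have hnorm : ellTwo (fun k => wNorm α β b k (fun ξ => ‖P k ξ‖ₑ)) < a := by
    refine lt_of_le_of_lt ?_ hlt
    rw [← ENNReal.pow_le_pow_left_iff two_ne_zero, ENNReal.rpow_half_sq,
      ellTwo_wNorm_sq (fun k ξ => ‖P k ξ‖ₑ) (by funext ξ; simp [hP0])]
    refine ENNReal.tsum_le_tsum fun ⟨k, hk⟩ => ?_
    calc ∫⁻ ξ, (ENNReal.ofReal (zWeight α β b k (2 * π * ξ)) * ‖P k ξ‖ₑ) ^ 2
        = ∫⁻ ξ, ENNReal.ofReal (zWeight α β b k (2 * π * ξ) * ‖F k (2 * π * ξ)‖) ^ 2 := by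
          refine lintegral_congr_ae ((hPF k hk).mono fun ξ hξ => ?_)
          dsimp only at hξ ⊢
          rw [ENNReal.ofReal_mul zWeight_pos.le, ofReal_norm, hξ]
      _ ≤ _ := by
          rw [lintegral_comp_mul_left_real h2π
            (fun τ => ENNReal.ofReal (zWeight α β b k τ * ‖F k τ‖) ^ 2)]
          refine mul_le_of_le_one_left' (ENNReal.ofReal_le_one.2 ?_)
          rw [abs_of_pos (by positivity)]
          exact inv_le_one_of_one_le₀ (by linarith [Real.pi_gt_three])
  have hPi : ∀ k, Integrable (P k) := fun k => by
    refine ⟨(hPm k).aestronglyMeasurable, ?_⟩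
    refine (lintegral_le_wNorm (α := α) (β := β) (k := k) hb (hPm k).enorm).trans_lt ?_
    exact ENNReal.mul_lt_top (bracketNorm_lt_top hb)
      ((wNorm_le_ellTwo (fun k ξ => ‖P k ξ‖ₑ) k).trans_lt (hnorm.trans_le le_top))
  refine ⟨P, hPm, hP0, hPi, hnorm.le, ?_⟩
  rw [ae_all_iff]
  intro k
  refine ae_eq_of_forall_schwartz (hw k).1 (continuous_fourierInv (hPi k)) fun φ hφ => ?_
  rw [← (hw k).2 φ hφ]
  rcases eq_or_ne k 0 with rfl | hk
  · rw [hw0, hP0]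
    simp [Real.fourierInv_eq]
  · exact (apply_eq_integral_fourierInv (hF k) (hPi k) (hPF k hk) φ).symm

/-- A function given on `(0, T)` by integrable time Fourier transforms is bounded in the restricted
norm. -/
lemma zNormT_le {α β b T : ℝ} {f : ℝ → ℤ → ℂ} {R : ℤ → ℝ → ℂ} (hR0 : R 0 = 0)
    (hR : ∀ k, Integrable (R k))
    (hf : ∀ᵐ t ∂volume.restrict (Set.Ioo 0 T), ∀ k, f t k = 𝓕⁻ (R k) t) :
    zNormT α β b T f ≤ ENNReal.ofReal (2 * π) ^ (1 / 2 : ℝ) *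
      ellTwo (fun k => wNorm α β b k (fun ξ => ‖R k ξ‖ₑ)) := by
  have h2π : (2 * π : ℝ) ≠ 0 := Real.two_pi_pos.ne'
  rw [ae_all_iff] at hf
  set w : SpaceTimeDist := fun k => 𝓕⁻ (Lp.toTemperedDistribution ((hR k).toL1 (R k))) with hw
  have hwk : ∀ k (φ : 𝓢(ℝ, ℂ)), w k φ = ∫ ξ, 𝓕⁻ φ ξ * R k ξ := fun k φ => by
    rw [hw, TemperedDistribution.fourierInv_apply, Lp.toTemperedDistribution_apply]
    refine integral_congr_ae ((hR k).coeFn_toL1.mono fun ξ hξ => ?_)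
    dsimp only
    rw [hξ, smul_eq_mul]
  have hagree : AgreesOnTime T w f := fun k => by
    have hc := continuous_fourierInv (hR k)
    refine ⟨?_, fun φ hφ => ?_⟩
    · refine Integrable.congr ?_ ((hf k).mono fun t ht => ht.symm)
      exact (hc.continuousOn.integrableOn_Icc (a := 0) (b := T)).mono_set Set.Ioo_subset_Icc_self
    · rw [hwk, integral_fourierInv_mul (hR k),
        ← setIntegral_eq_integral_of_forall_compl_eq_zero (s := Set.Ioo 0 T) fun t ht => by
          rw [image_eq_zero_of_notMem_tsupport fun h => ht (hφ h), zero_mul]]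
      refine integral_congr_ae ((hf k).mono fun t ht => ?_)
      dsimp only
      rw [ht]
  set F : ℤ → ℝ → ℂ := fun k τ => R k ((2 * π)⁻¹ * τ) with hFdef
  have hFR : ∀ k ξ, F k (2 * π * ξ) = R k ξ := fun k ξ => by
    rw [hFdef]; dsimp only; rw [inv_mul_cancel_left₀ h2π]
  have hF : w 0 = 0 ∧ ∀ k, HasTimeFourier (w k) (F k) := by
    refine ⟨?_, fun k => ⟨?_, fun φ => ⟨?_, ?_⟩⟩⟩
    · ext φ
      rw [hwk, hR0]
      simp
    · exact AEStronglyMeasurable.comp_const_mul (hR k).1 (inv_ne_zero h2π)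
    · simp_rw [hFR]
      exact (hR k).bdd_mul φ.continuous.aestronglyMeasurable
        (Filter.Eventually.of_forall fun t => SchwartzMap.norm_le_seminorm ℝ φ t)
    · simp_rw [hFR]
      rw [TemperedDistribution.fourier_apply, hwk, FourierTransform.fourierInv_fourier_eq]
  refine (iInf₂_le w hagree).trans ((iInf₂_le F hF).trans (le_of_eq ?_))
  rw [← ENNReal.sq_rpow_half (ellTwo _), ← ENNReal.mul_rpow_of_nonneg _ _ (by norm_num),
    ellTwo_wNorm_sq (fun k ξ => ‖R k ξ‖ₑ) (by funext ξ; simp [hR0]), ← ENNReal.tsum_mul_left]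
  congr 1
  refine tsum_congr fun k => ?_
  have : ∀ ξ, (ENNReal.ofReal (zWeight α β b k (2 * π * ξ)) * ‖R k ξ‖ₑ) ^ 2 =
      ENNReal.ofReal (zWeight α β b k (2 * π * ξ) * ‖F k (2 * π * ξ)‖) ^ 2 := fun ξ => by
    rw [ENNReal.ofReal_mul zWeight_pos.le, ofReal_norm, hFR]
  simp_rw [this]
  rw [lintegral_comp_mul_left_real h2π
    (fun τ => ENNReal.ofReal (zWeight α β b k τ * ‖F k τ‖) ^ 2), ← mul_assoc,
    ← ENNReal.ofReal_mul (by positivity), abs_of_pos (by positivity), mul_inv_cancel₀ h2π,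
    ENNReal.ofReal_one, one_mul]

/-! ### The time cut-off -/

lemma lintegral_enorm_schwartz_sq_lt_top (χ : 𝓢(ℝ, ℂ)) (j : ℕ) :
    ∫⁻ ξ, ENNReal.ofReal (|ξ| ^ j) * ‖χ ξ‖ₑ ^ 2 < ⊤ := by
  obtain ⟨C, hC⟩ : ∃ C, ∀ t, ‖χ t‖ ≤ C := ⟨_, fun t => SchwartzMap.norm_le_seminorm ℝ χ t⟩
  refine lt_of_le_of_lt (lintegral_mono fun ξ => ?_)
    ((SchwartzMap.integrable_pow_mul volume χ j).const_mul C).lintegral_lt_top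
  rw [← ofReal_norm, ← ENNReal.ofReal_pow (norm_nonneg _), ← ENNReal.ofReal_mul (by positivity),
    Real.norm_eq_abs]
  refine ENNReal.ofReal_le_ofReal ?_
  have h := hC ξ
  calc |ξ| ^ j * ‖χ ξ‖ ^ 2 = ‖χ ξ‖ * (|ξ| ^ j * ‖χ ξ‖) := by ring
    _ ≤ _ := by gcongr

lemma ltwo_schwartz_lt_top (χ : 𝓢(ℝ, ℂ)) : ltwo volume (fun ξ => ‖χ ξ‖ₑ) < ⊤ := by
  refine ENNReal.rpow_lt_top_of_nonneg (by norm_num) (ne_of_lt ?_)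
  simpa using lintegral_enorm_schwartz_sq_lt_top χ 0

lemma halfNorm_schwartz_lt_top (χ : 𝓢(ℝ, ℂ)) : halfNorm (fun ξ => ‖χ ξ‖ₑ) < ⊤ := by
  refine ENNReal.rpow_lt_top_of_nonneg (by norm_num) (ne_of_lt ?_)
  have h := lintegral_enorm_schwartz_sq_lt_top χ 1
  have e : ∀ ξ : ℝ, (ENNReal.ofReal (|2 * π * ξ| ^ (1 / 2 : ℝ)) * ‖χ ξ‖ₑ) ^ 2 =
      ENNReal.ofReal (2 * π) * (ENNReal.ofReal (|ξ| ^ 1) * ‖χ ξ‖ₑ ^ 2) := fun ξ => by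
    rw [mul_pow, ← ENNReal.ofReal_pow (by positivity), ← Real.rpow_mul_natCast (abs_nonneg _),
      ← mul_assoc, ← ENNReal.ofReal_mul (by positivity), abs_mul, abs_of_pos Real.two_pi_pos]
    norm_num
  simp_rw [e]
  rw [lintegral_const_mul' _ _ ENNReal.ofReal_ne_top]
  exact ENNReal.mul_lt_top ENNReal.ofReal_lt_top h

/-- There is a Schwartz function whose inverse Fourier transform equals one on `[0, 1]`. -/
lemma exists_schwartz_fourierInv_eq_one :
    ∃ χ : 𝓢(ℝ, ℂ), ∀ t ∈ Set.Icc (0 : ℝ) 1, 𝓕⁻ (χ : ℝ → ℂ) t = 1 := by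
  let ψ : ContDiffBump (0 : ℝ) := ⟨1, 2, by norm_num, by norm_num⟩
  have hc : HasCompactSupport (fun t => (ψ t : ℂ)) :=
    ψ.hasCompactSupport.comp_left (g := fun x : ℝ => (x : ℂ)) Complex.ofReal_zero
  have hd : ContDiff ℝ (⊤ : ℕ∞) (fun t => (ψ t : ℂ)) := Complex.ofRealCLM.contDiff.comp ψ.contDiff
  refine ⟨𝓕 (hc.toSchwartzMap hd), fun t ht => ?_⟩
  rw [← SchwartzMap.fourierInv_coe, FourierTransform.fourierInv_fourier_eq]
  have : ψ t = 1 := ψ.one_of_mem_closedBall (by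
    rw [Metric.mem_closedBall, Real.dist_eq, sub_zero, abs_of_nonneg ht.1]
    exact ht.2)
  change ((ψ t : ℝ) : ℂ) = 1
  rw [this, Complex.ofReal_one]

lemma fourierInv_rescale {T : ℝ} (hT : 0 < T) (χ : ℝ → ℂ) (t : ℝ) :
    𝓕⁻ (fun ξ => (T : ℂ) * χ (T * ξ)) t = 𝓕⁻ χ (t / T) := by
  rw [Real.fourierInv_eq', Real.fourierInv_eq']
  have h := Measure.integral_comp_mul_left
    (fun v : ℝ => Complex.exp ((↑(2 * π * inner ℝ v (t / T)) * Complex.I)) • χ v) T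
  rw [abs_of_pos (inv_pos.2 hT), eq_inv_smul_iff₀ hT.ne', ← integral_smul] at h
  rw [← h]
  refine integral_congr_ae (Filter.Eventually.of_forall fun v => ?_)
  simp only [smul_eq_mul, Complex.real_smul]
  have : inner ℝ (T * v) (t / T) = inner ℝ v t := by
    simp only [RCLike.inner_apply, conj_trivial]
    field_simp
  rw [this]
  ring

/-! ### The Fourier transform of the localized product -/

section Output

open ContinuousLinearMap

/-- The triple convolution which represents one interaction of spatial frequencies. -/
def tripleConv (P Q κ : ℝ → ℂ) : ℝ → ℂ :=
  convolution (convolution P Q (mul ℂ ℂ) volume) κ (mul ℂ ℂ) volume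

variable {P Q : ℤ → ℝ → ℂ} {κ : ℝ → ℂ}

/-- The time Fourier transform of the `k`-th spatial coefficient of the localized product. -/
def productTransform (P Q : ℤ → ℝ → ℂ) (κ : ℝ → ℂ) (k : ℤ) (ξ : ℝ) : ℂ :=
  ∑' l, tripleConv (P l) (Q (k - l)) κ ξ

lemma integrable_tripleConv {P Q : ℝ → ℂ} (hP : Integrable P) (hQ : Integrable Q)
    (hκ : Integrable κ) : Integrable (tripleConv P Q κ) :=
  (hP.integrable_convolution (mul ℂ ℂ) hQ).integrable_convolution (mul ℂ ℂ) hκ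

lemma enorm_tripleConv_le (P Q κ : ℝ → ℂ) (ξ : ℝ) :
    ‖tripleConv P Q κ ξ‖ₑ ≤
      lconv (lconv (fun x => ‖P x‖ₑ) (fun x => ‖Q x‖ₑ)) (fun x => ‖κ x‖ₑ) ξ :=
  (enorm_convolution_le _ _ ξ).trans
    (lconv_mono (fun x => enorm_convolution_le P Q x) (fun _ => le_rfl) ξ)

lemma lintegral_tripleConv_le {P Q : ℝ → ℂ} (hP : Measurable P) (hQ : Measurable Q)
    (hκ : Measurable κ) :
    ∫⁻ ξ, ‖tripleConv P Q κ ξ‖ₑ ≤ (∫⁻ ξ, ‖P ξ‖ₑ) * (∫⁻ ξ, ‖Q ξ‖ₑ) * ∫⁻ ξ, ‖κ ξ‖ₑ := by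
  refine (lintegral_mono (enorm_tripleConv_le P Q κ)).trans (le_of_eq ?_)
  rw [lintegral_lconv (measurable_lconv hP.enorm hQ.enorm) hκ.enorm,
    lintegral_lconv hP.enorm hQ.enorm]

lemma enorm_productTransform_le (k : ℤ) (ξ : ℝ) :
    ‖productTransform P Q κ k ξ‖ₑ ≤ ∑' l, lconv (lconv (fun x => ‖P l x‖ₑ)
      (fun x => ‖Q (k - l) x‖ₑ)) (fun x => ‖κ x‖ₑ) ξ :=
  enorm_tsum_le_tsum_enorm.trans (ENNReal.tsum_le_tsum fun _ => enorm_tripleConv_le _ _ _ ξ)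

lemma integrable_productTransform (hP : ∀ k, Integrable (P k)) (hQ : ∀ k, Integrable (Q k))
    (hκ : Integrable κ) {k : ℤ} (hsum : ∑' l, ∫⁻ ξ, ‖tripleConv (P l) (Q (k - l)) κ ξ‖ₑ ≠ ⊤) :
    Integrable (productTransform P Q κ k) := by
  have hm : ∀ l, AEMeasurable (tripleConv (P l) (Q (k - l)) κ) := fun l =>
    (integrable_tripleConv (hP l) (hQ _) hκ).aemeasurable
  refine ⟨(AEMeasurable.tsum hm).aestronglyMeasurable, ?_⟩
  refine (lintegral_mono fun ξ => enorm_tsum_le_tsum_enorm).trans_lt ?_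
  rw [lintegral_tsum fun l => (hm l).enorm]
  exact hsum.lt_top

/-- Convolutions become products, and summability of the L¹ norms permits exchanging the sum in l
with the integral. -/
lemma fourierInv_productTransform (hP : ∀ k, Integrable (P k)) (hQ : ∀ k, Integrable (Q k))
    (hκ : Integrable κ) {k : ℤ} (hsum : ∑' l, ∫⁻ ξ, ‖tripleConv (P l) (Q (k - l)) κ ξ‖ₑ ≠ ⊤)
    (t : ℝ) :
    𝓕⁻ (productTransform P Q κ k) t =
      (∑' l, 𝓕⁻ (P l) t * 𝓕⁻ (Q (k - l)) t) * 𝓕⁻ κ t := by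
  have hi : ∀ l, Integrable (tripleConv (P l) (Q (k - l)) κ) := fun l =>
    integrable_tripleConv (hP l) (hQ _) hκ
  rw [← tsum_mul_right]
  have h1 : ∀ l, 𝓕⁻ (P l) t * 𝓕⁻ (Q (k - l)) t * 𝓕⁻ κ t =
      𝓕⁻ (tripleConv (P l) (Q (k - l)) κ) t := fun l => by
    rw [tripleConv, fourierInv_mul_convolution
      ((hP l).integrable_convolution (mul ℂ ℂ) (hQ _)) hκ,
      fourierInv_mul_convolution (hP l) (hQ _)]
  simp_rw [h1, Real.fourierInv_eq']
  rw [← integral_tsum]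
  · refine integral_congr_ae (Filter.Eventually.of_forall fun ξ => ?_)
    simp only [productTransform, smul_eq_mul, tsum_mul_left]
  · intro l
    have hc : Continuous fun ξ : ℝ => Complex.exp (↑(2 * π * inner ℝ ξ t) * Complex.I) := by
      fun_prop
    exact hc.aestronglyMeasurable.smul (hi l).1
  · have : ∀ l ξ, ‖Complex.exp (↑(2 * π * inner ℝ ξ t) * Complex.I) •
        tripleConv (P l) (Q (k - l)) κ ξ‖ₑ = ‖tripleConv (P l) (Q (k - l)) κ ξ‖ₑ := fun l ξ => by
      rw [enorm_smul, ← ofReal_norm, Complex.norm_exp_ofReal_mul_I, ENNReal.ofReal_one, one_mul]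
    simp_rw [this]
    exact hsum

end Output

/-! ### The bilinear estimate -/

section Main

variable {α β b T : ℝ}

/-- The multiplier of the `k`-th spatial frequency, with the normalization of the product. -/
def outCoeff (β b : ℝ) (k : ℤ) : ℂ :=
  ((|(k : ℝ)| ^ (-(β * (b - 1 / 2))) : ℝ) : ℂ) * (Complex.I * (k : ℂ)) / (2 * π)

lemma enorm_outCoeff_le (k : ℤ) :
    ‖outCoeff β b k‖ₑ ≤ ENNReal.ofReal (|(k : ℝ)| ^ (-(β * (b - 1 / 2))) * |(k : ℝ)|) := by
  rw [← ofReal_norm]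
  refine ENNReal.ofReal_le_ofReal ?_
  have h0 : 0 ≤ |(k : ℝ)| ^ (-(β * (b - 1 / 2))) := by positivity
  have e : ‖outCoeff β b k‖ = |(k : ℝ)| ^ (-(β * (b - 1 / 2))) * |(k : ℝ)| / (2 * π) := by
    simp only [outCoeff, norm_div, norm_mul, Complex.norm_real, Complex.norm_I, one_mul,
      Complex.norm_intCast, Real.norm_eq_abs, Complex.norm_ofNat, abs_of_pos Real.pi_pos,
      abs_of_nonneg h0]
  rw [e]
  exact div_le_self (by positivity) (by linarith [Real.pi_gt_three])

/-- The bilinear estimate for functions given by their time Fourier transforms. -/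
lemma zNormT_product_le {χ : 𝓢(ℝ, ℂ)} (hχ : ∀ t ∈ Set.Icc (0 : ℝ) 1, 𝓕⁻ (χ : ℝ → ℂ) t = 1)
    (hα : 1 < α) (hαβ : 2 - α < β) (hβ : β ≤ 1) (hb : b = 1 / 2 + smallParam α β) (hT : 0 < T)
    {u v : ℝ → L2Torus} {P Q : ℤ → ℝ → ℂ}
    (hPm : ∀ k, Measurable (P k)) (hP0 : P 0 = 0) (hP : ∀ k, Integrable (P k))
    (hPn : ellTwo (fun k => wNorm α β b k (fun ξ => ‖P k ξ‖ₑ)) < ⊤)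
    (hu : ∀ᵐ t ∂volume.restrict (Set.Ioo 0 T), ∀ k, spatialCoeff (u t) k = 𝓕⁻ (P k) t)
    (hQm : ∀ k, Measurable (Q k)) (hQ0 : Q 0 = 0) (hQ : ∀ k, Integrable (Q k))
    (hQn : ellTwo (fun k => wNorm α β b k (fun ξ => ‖Q k ξ‖ₑ)) < ⊤)
    (hv : ∀ᵐ t ∂volume.restrict (Set.Ioo 0 T), ∀ k, spatialCoeff (v t) k = 𝓕⁻ (Q k) t) :
    zNormT α β (b - 1) T (fun t => fracDerivCoeff (-(β * (b - 1 / 2)))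
        (dxCoeff (spatialCoeff (fun x => u t x * v t x)))) ≤
      ENNReal.ofReal (2 * π) ^ (1 / 2 : ℝ) * bilinearConst α β b (fun ξ => ‖χ ξ‖ₑ) *
        ENNReal.ofReal (T ^ (smallParam α β / 2)) *
        (ellTwo (fun k => wNorm α β b k (fun ξ => ‖P k ξ‖ₑ)) *
          ellTwo (fun k => wNorm α β b k (fun ξ => ‖Q k ξ‖ₑ))) := by
  have hb' : 1 / 2 < b := by linarith [smallParam_pos hα hαβ]
  set κ : ℝ → ℂ := fun ξ => (T : ℂ) * χ (T * ξ) with hκdef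
  have hκ : Integrable κ := (χ.integrable.comp_mul_left' hT.ne').const_mul _
  have hκm : Measurable κ := by
    have := χ.continuous.measurable
    fun_prop
  have hκe : (fun ξ => ‖κ ξ‖ₑ) = rescale T (fun ξ => ‖χ ξ‖ₑ) := by
    funext ξ
    rw [hκdef, rescale, enorm_mul, ← ofReal_norm (T : ℂ), Complex.norm_real,
      Real.norm_of_nonneg hT.le]
  -- Each L¹ norm is at most a constant times A l * B (k - l), which is summable in l by
  -- Cauchy-Schwarz.
  have hsum : ∀ k, ∑' l, ∫⁻ ξ, ‖tripleConv (P l) (Q (k - l)) κ ξ‖ₑ ≠ ⊤ := fun k => by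
    have hA := bracketNorm_lt_top hb'
    have hκi : ∫⁻ ξ, ‖κ ξ‖ₑ < ⊤ := hκ.2
    set A := fun k => wNorm α β b k (fun ξ => ‖P k ξ‖ₑ)
    set B := fun k => wNorm α β b k (fun ξ => ‖Q k ξ‖ₑ)
    refine ne_of_lt (lt_of_le_of_lt (ENNReal.tsum_le_tsum
      (g := fun l => bracketNorm b * bracketNorm b * (∫⁻ ξ, ‖κ ξ‖ₑ) * (A l * B (k - l)))
      fun l => ?_) ?_)
    · refine (lintegral_tripleConv_le (hPm l) (hQm _) hκm).trans ?_
      have h1 : ∫⁻ ξ, ‖P l ξ‖ₑ ≤ bracketNorm b * A l := lintegral_le_wNorm hb' (hPm l).enorm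
      have h2 : ∫⁻ ξ, ‖Q (k - l) ξ‖ₑ ≤ bracketNorm b * B (k - l) :=
        lintegral_le_wNorm hb' (hQm _).enorm
      refine (mul_le_mul' (mul_le_mul' h1 h2) le_rfl).trans (le_of_eq ?_)
      ring
    · rw [ENNReal.tsum_mul_left]
      refine ENNReal.mul_lt_top (by finiteness) ?_
      refine (tsum_mul_le_ellTwo A (fun l => B (k - l))).trans_lt ?_
      rw [ellTwo_comp_sub]
      exact ENNReal.mul_lt_top hPn hQn
  set R : ℤ → ℝ → ℂ := fun k ξ =>
    if k = 0 then 0 else outCoeff β b k * productTransform P Q κ k ξ with hRdef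
  have hR0 : R 0 = 0 := by funext ξ; simp [hRdef]
  have hRk : ∀ k, k ≠ 0 → R k = fun ξ => outCoeff β b k * productTransform P Q κ k ξ :=
    fun k hk => by funext ξ; simp [hRdef, hk]
  have hR : ∀ k, Integrable (R k) := fun k => by
    rcases eq_or_ne k 0 with rfl | hk
    · rw [hR0]; exact integrable_zero _ _ _
    · rw [hRk k hk]
      exact (integrable_productTransform hP hQ hκ (hsum k)).const_mul _
  have hf : ∀ᵐ t ∂volume.restrict (Set.Ioo 0 T), ∀ k,
      fracDerivCoeff (-(β * (b - 1 / 2))) (dxCoeff (spatialCoeff (fun x => u t x * v t x))) k =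
        𝓕⁻ (R k) t := by
    filter_upwards [hu, hv, ae_restrict_mem measurableSet_Ioo] with t hut hvt ht k
    rcases eq_or_ne k 0 with rfl | hk
    · rw [hR0]
      simp [fracDerivCoeff, Real.fourierInv_eq]
    · have h1 : 𝓕⁻ κ t = 1 := by
        rw [hκdef, fourierInv_rescale hT]
        exact hχ _ ⟨div_nonneg ht.1.le hT.le, (div_le_one hT).2 ht.2.le⟩
      have h2 : 𝓕⁻ (R k) t = outCoeff β b k * 𝓕⁻ (productTransform P Q κ k) t := by
        rw [hRk k hk, Real.fourierInv_eq', Real.fourierInv_eq', ← integral_const_mul]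
        refine integral_congr_ae (Filter.Eventually.of_forall fun ξ => ?_)
        simp only [smul_eq_mul]
        ring
      rw [h2, fourierInv_productTransform hP hQ hκ (hsum k), h1, mul_one]
      have h3 := (hasSum_spatialCoeff_mul (u t) (v t) k).tsum_eq
      simp_rw [hut, hvt] at h3
      rw [h3, fracDerivCoeff, if_neg hk, dxCoeff, outCoeff]
      have : (2 * π : ℂ) ≠ 0 := by exact_mod_cast Real.two_pi_pos.ne'
      rw [div_mul_eq_mul_div, eq_div_iff this]
      ring
  refine (zNormT_le hR0 hR hf).trans ?_
  rw [mul_assoc, mul_assoc]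
  gcongr
  rw [← mul_assoc]
  refine le_trans (ltwo_mono fun k => ?_) (ellTwo_output_le hα hαβ hβ hb hT
    (fun k => (hPm k).enorm) (fun k => (hQm k).enorm) (by funext ξ; simp [hP0])
    (by funext ξ; simp [hQ0]) χ.continuous.measurable.enorm)
  split_ifs with hk
  · subst hk
    rw [hR0]
    simp [wNorm, ltwo]
  · refine ltwo_mono fun ξ => ?_
    rw [hRk k hk]
    dsimp only
    rw [enorm_mul]
    calc ENNReal.ofReal (zWeight α β (b - 1) k (2 * π * ξ)) *
          (‖outCoeff β b k‖ₑ * ‖productTransform P Q κ k ξ‖ₑ)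
        ≤ ENNReal.ofReal (zWeight α β (b - 1) k (2 * π * ξ)) *
          (ENNReal.ofReal (|(k : ℝ)| ^ (-(β * (b - 1 / 2))) * |(k : ℝ)|) *
            ∑' l, lconv (lconv (fun x => ‖P l x‖ₑ) (fun x => ‖Q (k - l) x‖ₑ))
              (fun x => ‖κ x‖ₑ) ξ) := by
          gcongr
          · exact enorm_outCoeff_le k
          · exact enorm_productTransform_le k ξ
      _ = _ := by
          rw [← mul_assoc, ← ENNReal.ofReal_mul zWeight_pos.le, ← ENNReal.tsum_mul_left, hκe]
          rfl

end Main

end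

theorem mainTheorem4 (α β : ℝ) (hα : 1 < α) (hαβ : 2 - α < β) (hβ : β ≤ 1) :
    ∃ ε : ℝ, 0 < ε ∧ ∃ b : ℝ, 1 / 2 < b ∧ ∃ C : ℝ, 0 < C ∧
      ∀ T : ℝ, 0 < T → T ≤ 1 →
      ∀ u v : ℝ → L2Torus,
        zNormTFun α β b T u < ⊤ → zNormTFun α β b T v < ⊤ →
        zNormT α β (b - 1) T
            (fun t => fracDerivCoeff (-(β * (b - 1 / 2)))
              (dxCoeff (spatialCoeff (fun x => u t x * v t x))))
          ≤ ENNReal.ofReal (C * T ^ ε) * zNormTFun α β b T u * zNormTFun α β b T v := by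
  obtain ⟨χ, hχ⟩ := exists_schwartz_fourierInv_eq_one
  have hθ := smallParam_pos hα hαβ
  set b := 1 / 2 + smallParam α β with hb
  have hb' : 1 / 2 < b := by linarith
  set D := ENNReal.ofReal (2 * π) ^ (1 / 2 : ℝ) * bilinearConst α β b (fun ξ => ‖χ ξ‖ₑ) with hD
  have hDtop : D < ⊤ := by
    have h := bilinearConst_lt_top (K := fun ξ => ‖χ ξ‖ₑ) hα hαβ hb χ.integrable.2
      (ltwo_schwartz_lt_top χ) (halfNorm_schwartz_lt_top χ)
    exact ENNReal.mul_lt_top (ENNReal.rpow_lt_top_of_nonneg (by norm_num)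
      ENNReal.ofReal_ne_top) h
  -- Adding 1 makes the constant positive, hence `E` nonzero and available for division.
  refine ⟨smallParam α β / 2, by linarith, b, hb', D.toReal + 1, by positivity, ?_⟩
  intro T hT _ u v hu hv
  set E := ENNReal.ofReal ((D.toReal + 1) * T ^ (smallParam α β / 2)) with hE
  have hE0 : E ≠ 0 := (ENNReal.ofReal_pos.2 (by positivity)).ne'
  have hEtop : E ≠ ⊤ := ENNReal.ofReal_ne_top
  have hDE : D * ENNReal.ofReal (T ^ (smallParam α β / 2)) ≤ E := by
    rw [hE, ENNReal.ofReal_mul (by positivity)]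
    gcongr
    rw [ENNReal.le_ofReal_iff_toReal_le hDtop.ne (by positivity)]
    linarith
  -- Dividing by `E` isolates the product of the two infima, which may then be tested on all a, a'
  -- strictly above them.
  rw [mul_assoc, mul_comm E, ← ENNReal.div_le_iff hE0 hEtop]
  refine ENNReal.le_mul_of_forall_lt (Or.inr hv.ne) (Or.inl hu.ne) fun a ha a' ha' => ?_
  rw [ENNReal.div_le_iff hE0 hEtop]
  -- The intermediate value keeps the norm of the profile finite even when a = ⊤.
  obtain ⟨a₁, ha₁, ha₁a⟩ := exists_between ha
  obtain ⟨a₂, ha₂, ha₂a⟩ := exists_between ha'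
  obtain ⟨P, hPm, hP0, hP, hPn, hPu⟩ := exists_profile hb' ha₁
  obtain ⟨Q, hQm, hQ0, hQ, hQn, hQv⟩ := exists_profile hb' ha₂
  refine (zNormT_product_le hχ hα hαβ hβ hb hT hPm hP0 hP
    (hPn.trans_lt (ha₁a.trans_le le_top)) hPu hQm hQ0 hQ
    (hQn.trans_lt (ha₂a.trans_le le_top)) hQv).trans ?_
  rw [mul_comm (a * a')]
  gcongr
  · exact hPn.trans ha₁a.le
  · exact hQn.trans ha₂a.le
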